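/- **Setting: wavelets.** Let $\varphi,\psi$ be the scaling function and (continuous) wavelet of an orthonormal multiresolution analysis of $L^2(\mathbb R)$, both supported in $[1-K,K]$, with $\varphi$ twice continuously differentiable and $\int x^i\psi(x)\,dx=0$ for $0\le i<N$ ($K,N\in\mathbb N$). Let $j_0>0$ with $2^{j_0}\ge 2N$, and let $$\varphi_{j_0,k}\ (0\le k<2^{j_0}),\qquad \psi_{j,k}\ (j\ge j_0,\ 0\le k<2^j)$$ be a boundary-corrected orthonormal wavelet basis of $L^2([0,1])$ (for example that of Cohen, Daubechies and Vial): for $k\in[N,2^j-N)$, $\varphi_{j_0,k}(x)=2^{j_0/2}\varphi(2^{j_0}x-k)$ and $\psi_{j,k}(x)=2^{j/2}\psi(2^jx-k)$; for $k<N$ the basis functions have the form $2^{j/2}g_k(2^jx)$, and for $k\ge 2^j-N$ the form $2^{j/2}\tilde g_{2^j-1-k}(2^j(1-x))$, where $g_i,\tilde g_i$, $0\le i<N$, are boundary functions on $[0,\infty)$ which do not depend on $j$, are twice continuously differentiable and have bounded support (one family for the scaling functions and one for the wavelets). **Classes.** For $f\in L^2([0,1])$ put $\alpha_k=\langle f,\varphi_{j_0,k}\rangle$,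 $\beta_{j,k}=\langle f,\psi_{j,k}\rangle$ and, for $s>0$, $$\|f\|_{C^s}=\max\Big(\sup_k|\alpha_k|,\ \sup_{j\ge j_0,\,k}2^{j(s+1/2)}|\beta_{j,k}|\Big),\qquad C^s(M)=\{f:\|f\|_{C^s}\le M\},$$ elements of $C^s(M)$ being identified with their continuous versions. For $j\ge i\ge j_0$ let $f_{i,j}=\sum_{l=i}^{j}\sum_k\beta_{l,k}\psi_{l,k}$, to which $\sum_k\alpha_k\varphi_{j_0,k}$ is added if $i=j_0$. Fix $s_{\max}\in(0,N)$, $\varepsilon\in(0,1)$ and an integer $\rho\ge1$. For $s\in(0,s_{\max}]$ and $M>0$, the self-similar class $C^s_0(M)$ consists of all $f\in C^s(M)$ with $\|f_{j,\rho j}\|_{C^s}\ge\varepsilon M$ for all $j\ge j_0$; if $s=s_{\max}$ this is required for $j=j_0$ only. **Model.** In the white noise model one observes the process $Y_t=\int_0^tf(u)\,du+n^{-1/2}B_t$, $t\in[0,1]$, where $B$ is a standard Brownian motion; $\mathbb P_f,\mathbb E_f$ refer to this observation. An estimator $\hat f_n$ is a function on $[0,1]$ determined by the observed path, whose value at each point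 is a measurable function of the path. Write $\|g\|_\infty=\sup_{x\in[0,1]}|g(x)|$. **Theorem.** In the white noise model, fix $0<\gamma<\frac12$, $s\in(0,s_{\max}]$ and $M>0$. 1. No sequence of estimators $\hat f_n$ satisfies $$\limsup_{n\to\infty}\ \sup_{f\in C^s_0(M)}\mathbb P_f\big(\|\hat f_n-f\|_\infty\ge r_n\big)\le\gamma$$ for any rate $r_n=o\big((n/\log n)^{-s/(2s+1)}\big)$. 2. Consequently the minimax rate over $C^s_0(M)$ is the same as over $C^s(M)$: for $\mathcal F=C^s_0(M)$ and for $\mathcal F=C^s(M)$ there are constants $0<c\le C$ such that, for all large $n$, $$c\,(n/\log n)^{-s/(2s+1)}\ \le\ \inf_{\hat f_n}\sup_{f\in\mathcal F}\mathbb E_f\|\hat f_n-f\|_\infty\ \le\ C\,(n/\log n)^{-s/(2s+1)}.$$ -/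

import Mathlib

open MeasureTheory ProbabilityTheory Filter Asymptotics
open scoped ENNReal NNReal Topology

noncomputable section

/-! ### Orthonormal multiresolution analyses of `L²(ℝ)` -/

/-- The dilated translate `x ↦ 2^{j/2} g(2^j x - k)`. -/
def dilate (g : ℝ → ℝ) (j k : ℤ) (x : ℝ) : ℝ :=
  (2 : ℝ) ^ ((j : ℝ) / 2) * g ((2 : ℝ) ^ j * x - k)

/-- The closed linear span in `L²(ℝ)` of the functions `dilate g j k`, `k ∈ ℤ`. -/
def scaleSpace (g : ℝ → ℝ) (j : ℤ) : Submodule ℝ (Lp ℝ 2 (volume : Measure ℝ)) :=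
  (Submodule.span ℝ
    {u : Lp ℝ 2 (volume : Measure ℝ) | ∃ k : ℤ, u =ᵐ[volume] dilate g j k}).topologicalClosure

/-- `φ` and `ψ` are the scaling function and the wavelet of an orthonormal multiresolution
analysis of `L²(ℝ)`, with approximation spaces `V_j = scaleSpace φ j`: the integer translates of
`ψ` are an orthonormal basis of the orthogonal complement of `V_0` in `V_1`. -/
structure IsOrthonormalMRA (φ ψ : ℝ → ℝ) : Prop where
  memLp_scaling : MemLp φ 2 volume
  memLp_wavelet : MemLp ψ 2 volume
  orthonormal_scaling : ∀ k l : ℤ, ∫ x : ℝ, φ (x - k) * φ (x - l) = if k = l then 1 else 0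
  mono : ∀ j : ℤ, scaleSpace φ j ≤ scaleSpace φ (j + 1)
  iInf_eq_bot : ⨅ j : ℤ, scaleSpace φ j = ⊥
  dense_iSup : (⨆ j : ℤ, scaleSpace φ j).topologicalClosure = ⊤
  orthonormal_wavelet : ∀ k l : ℤ, ∫ x : ℝ, ψ (x - k) * ψ (x - l) = if k = l then 1 else 0
  wavelet_space : scaleSpace ψ 0 = (scaleSpace φ 0)ᗮ ⊓ scaleSpace φ 1

/-! ### Wavelet bases of `L²([0,1])` -/

/-- The data of a boundary-corrected wavelet system on `[0,1]`: a scaling function `φ` and a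
wavelet `ψ` on the line, the support parameter `K`, the number `N` of vanishing moments, the
lowest resolution level `j₀`, and, at each end of the interval, boundary scaling functions and
boundary wavelets on the half-line (only those with index `< N` are used). -/
structure IntervalWavelets where
  φ : ℝ → ℝ
  ψ : ℝ → ℝ
  K : ℕ
  N : ℕ
  j₀ : ℕ
  φL : ℕ → ℝ → ℝ
  φR : ℕ → ℝ → ℝ
  ψL : ℕ → ℝ → ℝ
  ψR : ℕ → ℝ → ℝ

namespace IntervalWavelets

variable (W : IntervalWavelets)

/-- The `k`-th function at level `j`, `0 ≤ k < 2^j`: for `k ∈ [N, 2^j - N)` it is the scaling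
`2^{j/2} g(2^j x - k)`; for the `N` smallest (largest) values of `k` it is the corresponding
scaling of a left (right) boundary function, the right end being reflected to `0`. -/
def levelFn (g : ℝ → ℝ) (gL gR : ℕ → ℝ → ℝ) (j k : ℕ) (x : unitInterval) : ℝ :=
  if k < W.N then (2 : ℝ) ^ ((j : ℝ) / 2) * gL k ((2 : ℝ) ^ j * x)
  else if k + W.N < 2 ^ j then dilate g j k x
  else (2 : ℝ) ^ ((j : ℝ) / 2) * gR (2 ^ j - 1 - k) ((2 : ℝ) ^ j * (1 - x))

/-- The basis functions `φ_{j₀,k}`, `0 ≤ k < 2^{j₀}`. -/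
def scalingFn (k : ℕ) : unitInterval → ℝ := W.levelFn W.φ W.φL W.φR W.j₀ k

/-- The basis functions `ψ_{j,k}`, `j ≥ j₀`, `0 ≤ k < 2^j`. -/
def waveletFn (j k : ℕ) : unitInterval → ℝ := W.levelFn W.ψ W.ψL W.ψR j k

/-- Indices of the basis: `k < 2^{j₀}` for the scaling functions, and `(j, k)` with `j ≥ j₀`,
`k < 2^j`, for the wavelets. -/
abbrev Index : Type := Fin (2 ^ W.j₀) ⊕ (Σ j : Set.Ici W.j₀, Fin (2 ^ (j : ℕ)))

/-- The wavelet basis of `[0,1]`. -/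
def basisFn : W.Index → unitInterval → ℝ
  | .inl k => W.scalingFn k
  | .inr p => W.waveletFn p.1 p.2

/-- `φ`, `ψ` come from an orthonormal multiresolution analysis of `L²(ℝ)`, with `φ` twice
continuously differentiable, both supported in `[1 - K, K]`, and `ψ` with `N` vanishing moments;
the boundary functions have bounded support in `[0, ∞)` and are twice continuously differentiable
there; and the resulting system is an orthonormal basis of `L²([0,1])`.  The wavelet `ψ`, which a
multiresolution analysis determines only almost everywhere, is represented by its continuous
version.  The boundary-corrected bases of Cohen, Daubechies and Vial are of this form. -/
structure IsWaveletBasis : Prop where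
  isOrthonormalMRA : IsOrthonormalMRA W.φ W.ψ
  support_scaling : Function.support W.φ ⊆ Set.Icc (1 - (W.K : ℝ)) W.K
  support_wavelet : Function.support W.ψ ⊆ Set.Icc (1 - (W.K : ℝ)) W.K
  vanishing_moments : ∀ i < W.N, ∫ x : ℝ, x ^ i * W.ψ x = 0
  contDiff_scaling : ContDiff ℝ 2 W.φ
  continuous_wavelet : Continuous W.ψ
  level_pos : 0 < W.j₀
  level_large : 2 * W.N ≤ 2 ^ W.j₀
  contDiff_boundary : ∀ i < W.N,
    ContDiffOn ℝ 2 (W.φL i) (Set.Ici 0) ∧ ContDiffOn ℝ 2 (W.φR i) (Set.Ici 0) ∧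
    ContDiffOn ℝ 2 (W.ψL i) (Set.Ici 0) ∧ ContDiffOn ℝ 2 (W.ψR i) (Set.Ici 0)
  support_boundary : ∃ R : ℝ, ∀ i < W.N, ∀ x > R,
    W.φL i x = 0 ∧ W.φR i x = 0 ∧ W.ψL i x = 0 ∧ W.ψR i x = 0
  orthonormal : ∀ a b : W.Index, ∫ x, W.basisFn a x * W.basisFn b x = if a = b then 1 else 0
  complete : ∀ f : unitInterval → ℝ, MemLp f 2 volume →
    (∀ a : W.Index, ∫ x, f x * W.basisFn a x = 0) → f =ᵐ[volume] 0

/-! ### Smoothness classes and self-similar functions -/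

/-- The coefficients `α_k` of `f`. -/
def alpha (f : unitInterval → ℝ) (k : ℕ) : ℝ := ∫ x, f x * W.scalingFn k x

/-- The coefficients `β_{j,k}` of `f`. -/
def beta (f : unitInterval → ℝ) (j k : ℕ) : ℝ := ∫ x, f x * W.waveletFn j k x

/-- The `C^s` norm, `max (sup_k |α_k|, sup_{j,k} 2^{j(s+1/2)} |β_{j,k}|)`, with values in
`[0, ∞]`. -/
def cNorm (s : ℝ) (f : unitInterval → ℝ) : ℝ≥0∞ :=
  max (⨆ k : Fin (2 ^ W.j₀), ENNReal.ofReal |W.alpha f k|)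
    (⨆ (j : Set.Ici W.j₀) (k : Fin (2 ^ (j : ℕ))),
      ENNReal.ofReal ((2 : ℝ) ^ ((j : ℝ) * (s + 1 / 2)) * |W.beta f j k|))

/-- The part `f_{i,j}` of the wavelet series of `f` at resolution levels `i` to `j`, `i ≥ j₀`;
for `i = j₀` it includes the scaling functions. -/
def truncation (f : unitInterval → ℝ) (i j : ℕ) (x : unitInterval) : ℝ :=
  (if i = W.j₀ then ∑ k : Fin (2 ^ W.j₀), W.alpha f k * W.scalingFn k x else 0) +
    ∑ l ∈ Finset.Icc i j, ∑ k : Fin (2 ^ l), W.beta f l k * W.waveletFn l k x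

/-- The class `C^s(M)`.  For `s > 0` the wavelet series of a function with finite `C^s` norm
converges uniformly, so that each element of the class is represented by a continuous function. -/
def holderClass (s M : ℝ) : Set C(unitInterval, ℝ) :=
  {f | W.cNorm s f ≤ ENNReal.ofReal M}

/-- The class `C^s_0(M) = C^s_0(M, ε, ρ)` of self-similar functions: `f ∈ C^s(M)` with
`‖f_{j,ρj}‖_{C^s} ≥ ε M` for all `j ≥ j₀` if `s < smax`, and only for `j = j₀` if `s = smax`. -/
def selfSimilarClass (smax ε : ℝ) (ρ : ℕ) (s M : ℝ) : Set C(unitInterval, ℝ) :=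
  {f | f ∈ W.holderClass s M ∧ ∀ j : ℕ, W.j₀ ≤ j → (s = smax → j = W.j₀) →
    ENNReal.ofReal (ε * M) ≤ W.cNorm s (W.truncation f j (ρ * j))}

end IntervalWavelets

/-! ### The white noise model -/

/-- The observed path `Y_t = ∫_0^t f(u) du + n^{-1/2} B_t`, `t ∈ [0,1]`. -/
def whiteNoise {Ω : Type*} (B : ℝ≥0 → Ω → ℝ) (n : ℕ) (f : C(unitInterval, ℝ)) (ω : Ω) :
    unitInterval → ℝ :=
  fun t ↦ (∫ u in Set.Iic t, f u) + (√(n : ℝ))⁻¹ * B (unitInterval.toNNReal t) ω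

/-- An estimator assigns a function on `[0,1]` to each observed path, such that its value at each
point is a measurable function of the path. -/
def IsEstimator (T : (unitInterval → ℝ) → unitInterval → ℝ) : Prop :=
  ∀ x, Measurable fun y ↦ T y x

/-- The supremum distance `sup_{x ∈ [0,1]} |g(x) - f(x)|`, with values in `[0, ∞]`. -/
def supDist (g f : unitInterval → ℝ) : ℝ≥0∞ := ⨆ x, ENNReal.ofReal |g x - f x|

/-- The minimax risk `inf_T sup_{f ∈ F} E_f ‖T(Y) - f‖_∞` over the class `F`, the infimum being
over all estimators. -/
def minimaxRisk {Ω : Type*} [MeasurableSpace Ω] (P : Measure Ω) (B : ℝ≥0 → Ω → ℝ)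
    (F : Set C(unitInterval, ℝ)) (n : ℕ) : ℝ≥0∞ :=
  ⨅ (T : (unitInterval → ℝ) → unitInterval → ℝ) (_ : IsEstimator T),
    ⨆ f ∈ F, ∫⁻ ω, supDist (T (whiteNoise B n f ω)) f ∂P

/-- The minimax risk over `F` is of exact order `r n`, up to positive constants. -/
def IsMinimaxRate {Ω : Type*} [MeasurableSpace Ω] (P : Measure Ω) (B : ℝ≥0 → Ω → ℝ)
    (F : Set C(unitInterval, ℝ)) (r : ℕ → ℝ) : Prop :=
  ∃ c > 0, ∃ C > 0, ∀ᶠ n : ℕ in atTop,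
    ENNReal.ofReal (c * r n) ≤ minimaxRisk P B F n ∧
    minimaxRisk P B F n ≤ ENNReal.ofReal (C * r n)

/-- The rate `(n / log n)^{-s/(2s+1)}`. -/
def optimalRate (s : ℝ) (n : ℕ) : ℝ := ((n : ℝ) / Real.log n) ^ (-s / (2 * s + 1))

end

/-! Lower bound. One wavelet coefficient per level suffices for self-similarity. Let `f` have
`β_{j,0} = M 2^{-j(s+1/2)}` at every level and no other coefficient (`exists_base`). Then `f`, and
every `f + δ ψ_{j,k}` with `k ≠ 0` and `δ ≤ M 2^{-j(s+1/2)}`, is self-similar (`base_add_mem`), so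
the class contains the usual localized alternatives. Put `Q = n / log n`, choose `2^j` of order
`Q^{1/(2s+1)}` and `δ = √η Q^{-1/2}`, and keep `m` of the translates, `m` of order `2^j`, with
disjoint supports. Each has squared signal-to-noise ratio `n δ² = η log n`. The averaged likelihood
ratio of the alternatives to `f` has variance at most `e^{n δ²} / m = n^η / m`, which is small for
small `η`; no event then separates `f` from the mixture (`sum_pi_gaussianReal_le`,
`sum_whiteNoise_le`). An estimator with error below half the height of each bump would provide such
an event (`exists_estimator_error`). Hence an error of order `δ 2^{j/2}`, that is `Q^{-s/(2s+1)}`,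
has probability at least any given `γ < 1/2` (`exists_lower_bound`). This refutes a faster rate and,
by Markov's inequality, bounds the risk from below.

The likelihood ratio is computed only for finitely many increments, which are independent Gaussians.
Cauchy–Schwarz bounds their information by that of the whole path, and cylinders approximate every
event of path space.

Upper bound. Project on the levels up to `J`, with `2^J` of order `Q^{1/(2s+1)}`. The bias is of
order `2^{-Js}` (`exists_approx`). The noise is at most `2^{J/2}`, a bound for the sum of the basis
functions, times the largest of at most `3n` Gaussian errors, whose mean is of order `√(log n / n)`
by exponential moments (`lintegral_supDist_projectionEstimator_le`).

The lower bound is proved on the smaller class and the upper bound on the larger one; inclusion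
gives the rest. -/

noncomputable section

/-! ### Gaussian likelihood ratios on the line -/

/-- The likelihood ratio of `gaussianReal a v` with respect to `gaussianReal 0 v`. -/
def gaussianRatio (a : ℝ) (v : ℝ≥0) (x : ℝ) : ℝ := Real.exp (a / v * x - a ^ 2 / (2 * v))

lemma measurable_gaussianRatio (a : ℝ) (v : ℝ≥0) : Measurable (gaussianRatio a v) := by
  unfold gaussianRatio; fun_prop

lemma gaussianRatio_pos (a : ℝ) (v : ℝ≥0) (x : ℝ) : 0 < gaussianRatio a v x := Real.exp_pos _

lemma gaussianReal_eq_withDensity (a : ℝ) {v : ℝ≥0} (hv : v ≠ 0) :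
    gaussianReal a v =
      (gaussianReal 0 v).withDensity (fun x ↦ ENNReal.ofReal (gaussianRatio a v x)) := by
  rw [gaussianReal_of_var_ne_zero _ hv, gaussianReal_of_var_ne_zero _ hv,
    ← withDensity_mul _ (measurable_gaussianPDF 0 v)
      (measurable_gaussianRatio a v).ennreal_ofReal]
  congr 1
  ext x
  have hv' : (v : ℝ) ≠ 0 := by exact_mod_cast hv
  rw [Pi.mul_apply, gaussianPDF, gaussianPDF, ← ENNReal.ofReal_mul (gaussianPDFReal_nonneg _ _ _)]
  congr 1
  rw [gaussianPDFReal, gaussianPDFReal, gaussianRatio, mul_assoc _ (Real.exp _), ← Real.exp_add]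
  congr 2
  field_simp
  ring

lemma gaussianRatio_mul_eq (a b : ℝ) (v : ℝ≥0) (x : ℝ) :
    gaussianRatio a v x * gaussianRatio b v x =
      Real.exp (-(a ^ 2 + b ^ 2) / (2 * v)) * Real.exp ((a + b) / v * x) := by
  rw [gaussianRatio, gaussianRatio, ← Real.exp_add, ← Real.exp_add]
  congr 1
  ring

lemma integrable_gaussianRatio (a : ℝ) (v : ℝ≥0) :
    Integrable (gaussianRatio a v) (gaussianReal 0 v) := by
  have h := (integrable_exp_mul_gaussianReal (μ := 0) (v := v) (a / v)).const_mul
    (Real.exp (-(a ^ 2 / (2 * v))))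
  refine h.congr (ae_of_all _ fun x ↦ ?_)
  simp only [gaussianRatio]
  rw [← Real.exp_add]
  congr 1
  ring

lemma integrable_gaussianRatio_mul (a b : ℝ) (v : ℝ≥0) :
    Integrable (fun x ↦ gaussianRatio a v x * gaussianRatio b v x) (gaussianReal 0 v) := by
  simp only [gaussianRatio_mul_eq]
  exact (integrable_exp_mul_gaussianReal _).const_mul _

/-- The value is `1` when `a * b = 0`: this is why orthogonal shifts do not correlate in the second
moment of an averaged likelihood ratio. -/
lemma integral_gaussianRatio_mul (a b : ℝ) {v : ℝ≥0} (hv : v ≠ 0) :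
    ∫ x, gaussianRatio a v x * gaussianRatio b v x ∂(gaussianReal 0 v) =
      Real.exp (a * b / v) := by
  have hv' : (v : ℝ) ≠ 0 := by exact_mod_cast hv
  have h := congrFun (mgf_id_gaussianReal (μ := 0) (v := v)) ((a + b) / v)
  simp only [mgf, id] at h
  simp only [gaussianRatio_mul_eq]
  rw [integral_const_mul, h, ← Real.exp_add]
  congr 1
  field_simp
  ring

lemma integral_gaussianRatio (a : ℝ) {v : ℝ≥0} (hv : v ≠ 0) :
    ∫ x, gaussianRatio a v x ∂(gaussianReal 0 v) = 1 := by
  have h := integral_gaussianRatio_mul a 0 hv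
  simpa [gaussianRatio] using h

/-! ### Mixtures of shifted product Gaussians -/

section Product

variable {d : Type*} [Fintype d]

/-- The likelihood ratio of a product of Gaussian laws with respect to the centred one. -/
def piGaussianRatio (a : d → ℝ) (v : d → ℝ≥0) (x : d → ℝ) : ℝ :=
  ∏ i, gaussianRatio (a i) (v i) (x i)

lemma piGaussianRatio_nonneg (a : d → ℝ) (v : d → ℝ≥0) (x : d → ℝ) :
    0 ≤ piGaussianRatio a v x :=
  Finset.prod_nonneg fun _ _ ↦ (gaussianRatio_pos _ _ _).le

lemma integrable_piGaussianRatio (a : d → ℝ) (v : d → ℝ≥0) :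
    Integrable (piGaussianRatio a v) (Measure.pi fun i ↦ gaussianReal 0 (v i)) :=
  Integrable.fintype_prod (f := fun i ↦ gaussianRatio (a i) (v i))
    fun i ↦ integrable_gaussianRatio (a i) (v i)

lemma integral_piGaussianRatio (a : d → ℝ) {v : d → ℝ≥0} (hv : ∀ i, v i ≠ 0) :
    ∫ x, piGaussianRatio a v x ∂(Measure.pi fun i ↦ gaussianReal 0 (v i)) = 1 := by
  unfold piGaussianRatio
  rw [integral_fintype_prod_eq_prod (f := fun i ↦ gaussianRatio (a i) (v i))]
  exact Finset.prod_eq_one fun i _ ↦ integral_gaussianRatio _ (hv i)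

lemma integrable_piGaussianRatio_mul (a b : d → ℝ) (v : d → ℝ≥0) :
    Integrable (fun x ↦ piGaussianRatio a v x * piGaussianRatio b v x)
      (Measure.pi fun i ↦ gaussianReal 0 (v i)) := by
  simp only [piGaussianRatio, ← Finset.prod_mul_distrib]
  exact Integrable.fintype_prod
    (f := fun i x ↦ gaussianRatio (a i) (v i) x * gaussianRatio (b i) (v i) x)
    fun i ↦ integrable_gaussianRatio_mul (a i) (b i) (v i)

lemma integral_piGaussianRatio_mul (a b : d → ℝ) {v : d → ℝ≥0} (hv : ∀ i, v i ≠ 0) :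
    ∫ x, piGaussianRatio a v x * piGaussianRatio b v x
      ∂(Measure.pi fun i ↦ gaussianReal 0 (v i)) = Real.exp (∑ i, a i * b i / v i) := by
  simp only [piGaussianRatio, ← Finset.prod_mul_distrib]
  rw [integral_fintype_prod_eq_prod
    (f := fun i x ↦ gaussianRatio (a i) (v i) x * gaussianRatio (b i) (v i) x), Real.exp_sum]
  exact Finset.prod_congr rfl fun i _ ↦ integral_gaussianRatio_mul _ _ (hv i)

lemma pi_gaussianReal_eq_withDensity (a : d → ℝ) {v : d → ℝ≥0} (hv : ∀ i, v i ≠ 0) :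
    (Measure.pi fun i ↦ gaussianReal (a i) (v i)) =
      (Measure.pi fun i ↦ gaussianReal 0 (v i)).withDensity
        (fun x ↦ ENNReal.ofReal (piGaussianRatio a v x)) := by
  refine Measure.pi_eq fun s hs ↦ ?_
  rw [withDensity_apply _ (MeasurableSet.univ_pi hs), Measure.restrict_pi_pi]
  rw [← ofReal_integral_eq_lintegral_ofReal]
  · unfold piGaussianRatio
    rw [integral_fintype_prod_eq_prod (f := fun i ↦ gaussianRatio (a i) (v i)),
      ENNReal.ofReal_prod_of_nonneg
        fun i _ ↦ integral_nonneg fun x ↦ (gaussianRatio_pos _ _ _).le]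
    refine Finset.prod_congr rfl fun i _ ↦ ?_
    rw [gaussianReal_eq_withDensity (a i) (hv i), withDensity_apply _ (hs i),
      ofReal_integral_eq_lintegral_ofReal (integrable_gaussianRatio _ _).integrableOn
      (ae_of_all _ fun x ↦ (gaussianRatio_pos _ _ _).le)]
  · exact Integrable.fintype_prod (f := fun i ↦ gaussianRatio (a i) (v i))
      fun i ↦ (integrable_gaussianRatio (a i) (v i)).integrableOn
  · exact ae_of_all _ fun x ↦ piGaussianRatio_nonneg _ _ _

lemma pi_gaussianReal_real_apply (a : d → ℝ) {v : d → ℝ≥0} (hv : ∀ i, v i ≠ 0)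
    {A : Set (d → ℝ)} (hA : MeasurableSet A) :
    (Measure.pi fun i ↦ gaussianReal (a i) (v i)).real A =
      ∫ x in A, piGaussianRatio a v x ∂(Measure.pi fun i ↦ gaussianReal 0 (v i)) := by
  rw [Measure.real, pi_gaussianReal_eq_withDensity a hv, withDensity_apply _ hA,
    ← ofReal_integral_eq_lintegral_ofReal (integrable_piGaussianRatio a v).integrableOn
      (ae_of_all _ fun x ↦ piGaussianRatio_nonneg _ _ _),
    ENNReal.toReal_ofReal (integral_nonneg fun x ↦ piGaussianRatio_nonneg _ _ _)]

/-- A uniform mixture of `m` orthogonal shifts of a centred Gaussian law, each of squared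
signal-to-noise ratio at most `S`, is within `√(e^S / m)` of that law. -/
theorem sum_pi_gaussianReal_le {ι : Type*} [Fintype ι] [Nonempty ι] (a : ι → d → ℝ)
    {v : d → ℝ≥0} (hv : ∀ i, v i ≠ 0) {S : ℝ}
    (horth : ∀ k l, k ≠ l → ∀ i, a k i * a l i = 0)
    (hS : ∀ k, ∑ i, a k i ^ 2 / v i ≤ S) {A : Set (d → ℝ)} (hA : MeasurableSet A) :
    (∑ k, (Measure.pi fun i ↦ gaussianReal (a k i) (v i)).real A) / Fintype.card ι ≤
      (Measure.pi fun i ↦ gaussianReal 0 (v i)).real A +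
        √(Real.exp S / Fintype.card ι) := by
  classical
  set ν := Measure.pi fun i ↦ gaussianReal 0 (v i) with hν
  set m : ℝ := (Fintype.card ι : ℝ) with hm
  have hm0 : 0 < m := by rw [hm]; exact_mod_cast Fintype.card_pos
  set c : ℝ := √(Real.exp S / m) with hc
  have hc0 : 0 < c := Real.sqrt_pos.2 (by positivity)
  have hc2 : c ^ 2 = Real.exp S / m := Real.sq_sqrt (by positivity)
  let L : (d → ℝ) → ℝ := fun x ↦ (∑ k, piGaussianRatio (a k) v x) / m
  have hLi : Integrable L ν :=
    (integrable_finsetSum _ fun k _ ↦ integrable_piGaussianRatio (a k) v).div_const m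
  have hL1 : ∫ x, L x ∂ν = 1 := by
    simp only [L]
    rw [integral_div, integral_finsetSum _ fun k _ ↦ integrable_piGaussianRatio (a k) v]
    simp only [integral_piGaussianRatio _ hv]
    simp [← hm, hm0.ne']
  have hL2eq : ∀ x, L x ^ 2 = (∑ k, ∑ l, piGaussianRatio (a k) v x * piGaussianRatio (a l) v x)
      / m ^ 2 := fun x ↦ by
    simp only [L, div_pow, sq (∑ k, _), Finset.sum_mul_sum]
  have hL2i : Integrable (fun x ↦ L x ^ 2) ν := by
    simp only [hL2eq]
    exact (integrable_finsetSum _ fun k _ ↦ integrable_finsetSum _ fun l _ ↦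
      integrable_piGaussianRatio_mul (a k) (a l) v).div_const _
  -- By orthogonality an off-diagonal pair integrates to `1`, and a diagonal one to at most `e^S`.
  -- Each row of the double sum is therefore at most `m + e^S`.
  have hL2 : ∫ x, L x ^ 2 ∂ν ≤ 1 + c ^ 2 := by
    simp only [hL2eq]
    rw [integral_div, integral_finsetSum _ fun k _ ↦ integrable_finsetSum _ fun l _ ↦
      integrable_piGaussianRatio_mul (a k) (a l) v]
    have h1 : ∀ k, ∫ x, ∑ l, piGaussianRatio (a k) v x * piGaussianRatio (a l) v x ∂ν
        ≤ m + Real.exp S := fun k ↦ by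
      rw [integral_finsetSum _ fun l _ ↦ integrable_piGaussianRatio_mul (a k) (a l) v]
      calc ∑ l, ∫ x, piGaussianRatio (a k) v x * piGaussianRatio (a l) v x ∂ν
          ≤ ∑ l, (1 + if l = k then Real.exp S else 0) := by
            refine Finset.sum_le_sum fun l _ ↦ ?_
            rw [hν, integral_piGaussianRatio_mul _ _ hv]
            split_ifs with h
            · subst h
              have : Real.exp (∑ i, a l i * a l i / v i) ≤ Real.exp S :=
                Real.exp_le_exp.2 (by simpa [sq] using hS l)
              linarith
            · rw [Finset.sum_eq_zero fun i _ ↦ by rw [horth k l (Ne.symm h) i, zero_div]]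
              simp
        _ = m + Real.exp S := by
            rw [Finset.sum_add_distrib]; simp [hm]
    calc (∑ k, ∫ x, ∑ l, piGaussianRatio (a k) v x * piGaussianRatio (a l) v x ∂ν) / m ^ 2
        ≤ (∑ _k : ι, (m + Real.exp S)) / m ^ 2 := by
          gcongr with k; exact h1 k
      _ = 1 + c ^ 2 := by
          rw [hc2, Finset.sum_const, Finset.card_univ, nsmul_eq_mul, ← hm]; field_simp
  have hsq : Integrable (fun x ↦ (L x - 1) ^ 2) ν := by
    refine ((hL2i.sub (hLi.const_mul 2)).add (integrable_const 1)).congr (ae_of_all _ fun x ↦ ?_)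
    simp only [Pi.add_apply, Pi.sub_apply]; ring
  have hsq2 : ∫ x, (L x - 1) ^ 2 ∂ν ≤ c ^ 2 := by
    have : ∫ x, (L x - 1) ^ 2 ∂ν = ∫ x, (L x ^ 2 - 2 * L x + 1) ∂ν := by
      congr 1; ext x; ring
    have hi : Integrable (fun x ↦ L x ^ 2 - 2 * L x) ν := hL2i.sub (hLi.const_mul 2)
    rw [this, integral_add hi (integrable_const _), integral_sub hL2i (hLi.const_mul 2),
      integral_const_mul, hL1]
    simp
    linarith
  -- From `(L - 1 - c)² ≥ 0`, a nonnegative majorant of `L - 1` whose integral over the whole space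
  -- is at most `c / 2 + c / 2`.
  have key : ∫ x in A, (L x - 1) ∂ν ≤ c := by
    have hbd : Integrable (fun x ↦ c / 2 + (L x - 1) ^ 2 / (2 * c)) ν :=
      (integrable_const _).add (hsq.div_const _)
    calc ∫ x in A, (L x - 1) ∂ν ≤ ∫ x in A, (c / 2 + (L x - 1) ^ 2 / (2 * c)) ∂ν := by
          refine integral_mono (hLi.sub (integrable_const _)).integrableOn hbd.integrableOn
            fun x ↦ ?_
          have : 0 ≤ (L x - 1 - c) ^ 2 / (2 * c) := by positivity
          have h2 : (L x - 1 - c) ^ 2 / (2 * c) =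
            c / 2 + (L x - 1) ^ 2 / (2 * c) - (L x - 1) := by field_simp; ring
          simp only
          linarith
      _ ≤ ∫ x, (c / 2 + (L x - 1) ^ 2 / (2 * c)) ∂ν :=
          setIntegral_le_integral hbd (ae_of_all _ fun x ↦ by positivity)
      _ = c / 2 + (∫ x, (L x - 1) ^ 2 ∂ν) / (2 * c) := by
          rw [integral_add (integrable_const _) (hsq.div_const _), integral_div (2 * c)]; simp
      _ ≤ c / 2 + c ^ 2 / (2 * c) := by gcongr
      _ = c := by field_simp; ring
  rw [integral_sub hLi.integrableOn (integrable_const _).integrableOn] at key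
  have hAL : (∑ k, (Measure.pi fun i ↦ gaussianReal (a k i) (v i)).real A) / m =
      ∫ x in A, L x ∂ν := by
    simp only [L]
    rw [integral_div, integral_finsetSum _ fun k _ ↦
      (integrable_piGaussianRatio (a k) v).integrableOn]
    congr 1
    exact Finset.sum_congr rfl fun k _ ↦ pi_gaussianReal_real_apply (a k) hv hA
  rw [hAL]
  simp at key
  linarith

end Product

/-! ### Integrals over cells of the unit interval -/

section UnitInterval

lemma integrable_unitInterval {f : unitInterval → ℝ} (hf : Continuous f) :
    Integrable f volume := by
  rw [← integrableOn_univ]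
  exact hf.continuousOn.integrableOn_compact isCompact_univ

lemma setIntegral_Iic_sub {f : unitInterval → ℝ} (hf : Continuous f) {s t : unitInterval}
    (hst : s ≤ t) :
    (∫ u in Set.Iic t, f u) - ∫ u in Set.Iic s, f u = ∫ u in Set.Ioc s t, f u := by
  have hi := integrable_unitInterval hf
  rw [← Set.Iic_union_Ioc_eq_Iic hst, setIntegral_union (Set.Iic_disjoint_Ioc le_rfl)
    measurableSet_Ioc hi.integrableOn hi.integrableOn]
  ring

lemma sum_setIntegral_Ioc {t : ℕ → unitInterval} (ht : Monotone t) {g : unitInterval → ℝ}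
    (hg : Integrable g) (k : ℕ) :
    ∑ i ∈ Finset.range k, ∫ u in Set.Ioc (t i) (t (i + 1)), g u =
      ∫ u in Set.Ioc (t 0) (t k), g u := by
  induction k with
  | zero => simp
  | succ k ih =>
    rw [Finset.sum_range_succ, ih,
      ← Set.Ioc_union_Ioc_eq_Ioc (ht (Nat.zero_le k)) (ht (Nat.le_succ k)),
      setIntegral_union (Set.Ioc_disjoint_Ioc_of_le le_rfl) measurableSet_Ioc
      hg.integrableOn hg.integrableOn]

/-- Cauchy–Schwarz against the constant `1`: expand `∫ (h - c)² ≥ 0` and take for `c` the mean of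
`h` on `E`. -/
lemma sq_setIntegral_le {h : unitInterval → ℝ} (hh : Continuous h) (E : Set unitInterval) :
    (∫ u in E, h u) ^ 2 ≤ volume.real E * ∫ u in E, h u ^ 2 := by
  have hi : IntegrableOn h E := (integrable_unitInterval hh).integrableOn
  have hi2 : IntegrableOn (fun u ↦ h u ^ 2) E := (integrable_unitInterval (hh.pow 2)).integrableOn
  set p := ∫ u in E, h u
  set q := ∫ u in E, h u ^ 2
  set V := volume.real E
  have hq : 0 ≤ q := integral_nonneg fun u ↦ sq_nonneg _
  have hV : 0 ≤ V := measureReal_nonneg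
  have key : ∀ c : ℝ, 0 ≤ q - 2 * c * p + c ^ 2 * V := fun c ↦ by
    have h0 : 0 ≤ ∫ u in E, (h u - c) ^ 2 := integral_nonneg fun u ↦ sq_nonneg _
    have h1 : ∫ u in E, (h u - c) ^ 2 = ∫ u in E, (h u ^ 2 - 2 * c * h u + c ^ 2) := by
      congr 1; ext u; ring
    have hi3 : IntegrableOn (fun u ↦ h u ^ 2 - 2 * c * h u) E := hi2.sub (hi.const_mul _)
    rw [h1, integral_add hi3 (integrable_const _), integral_sub hi2 (hi.const_mul _),
      integral_const_mul] at h0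
    simp only [integral_const, measureReal_restrict_apply_univ, smul_eq_mul] at h0
    linarith
  rcases hV.eq_or_lt with h0 | hVpos
  · have : p = 0 := by
      have hE : volume E = 0 := by
        rwa [eq_comm, measureReal_eq_zero_iff] at h0
      exact setIntegral_measure_zero _ hE
    rw [this, ← h0]; simp
  · have := key (p / V)
    have h2 : q - 2 * (p / V) * p + (p / V) ^ 2 * V = (V * q - p ^ 2) / V := by
      field_simp; ring
    rw [h2] at this
    have := nonneg_of_mul_nonneg_left (by rwa [div_eq_mul_inv] at this) (inv_pos.2 hVpos)
    linarith

end UnitInterval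

/-! ### Finite-dimensional laws of the white noise path -/

section WhiteNoise

lemma whiteNoise_add {Ω : Type*} {B : ℝ≥0 → Ω → ℝ} (n : ℕ) (f g : C(unitInterval, ℝ)) (ω : Ω) :
    whiteNoise B n (f + g) ω = fun t ↦ whiteNoise B n g ω t + ∫ u in Set.Iic t, f u := by
  ext t
  simp only [whiteNoise, ContinuousMap.add_apply]
  rw [integral_add (integrable_unitInterval f.continuous).integrableOn
    (integrable_unitInterval g.continuous).integrableOn]
  ring

lemma whiteNoise_increment {Ω : Type*} {B : ℝ≥0 → Ω → ℝ} (n : ℕ)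
    (h : C(unitInterval, ℝ)) (ω : Ω) {s t : unitInterval}
    (hst : s ≤ t) :
    whiteNoise B n h ω t - whiteNoise B n h ω s =
      (∫ u in Set.Ioc s t, h u) + (√(n : ℝ))⁻¹ *
        (B (unitInterval.toNNReal t) ω - B (unitInterval.toNNReal s) ω) := by
  rw [← setIntegral_Iic_sub h.continuous hst, whiteNoise, whiteNoise]
  ring

variable {Ω : Type*} [MeasurableSpace Ω] {P : Measure Ω} {B : ℝ≥0 → Ω → ℝ}

lemma aemeasurable_whiteNoise (hB : IsPreBrownianReal B P) (n : ℕ) (h : C(unitInterval, ℝ))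
    (t : unitInterval) : AEMeasurable (fun ω ↦ whiteNoise B n h ω t) P :=
  ((hB.aemeasurable _).const_mul _).const_add _

/-- Each `B t` is only almost everywhere measurable, so the path is a measurable map for the
completion of `P`; coordinates suffice for the product σ-algebra. -/
lemma nullMeasurable_whiteNoise (hB : IsPreBrownianReal B P) (n : ℕ) (h : C(unitInterval, ℝ)) :
    NullMeasurable (whiteNoise B n h) P := by
  have : @Measurable (NullMeasurableSpace Ω P) _ _ _ (whiteNoise B n h) :=
    measurable_pi_iff.2 fun t ↦ (aemeasurable_whiteNoise hB n h t).nullMeasurable.measurable'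
  exact this

/-- The variance of the increment over `(s, t]` of the white noise path. -/
def incrementVar (n : ℕ) (s t : unitInterval) : ℝ≥0 :=
  .mk ((√(n : ℝ))⁻¹ ^ 2) (sq_nonneg _) *
    nndist (unitInterval.toNNReal t).1 (unitInterval.toNNReal s).1

lemma coe_incrementVar {n : ℕ} {s t : unitInterval} (hst : s ≤ t) :
    (incrementVar n s t : ℝ) = ((t : ℝ) - s) / n := by
  have h : (0 : ℝ) ≤ t - s := sub_nonneg.2 hst
  simp only [incrementVar, NNReal.coe_mul, NNReal.coe_mk, coe_nndist, inv_pow,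
    Real.sq_sqrt (Nat.cast_nonneg n)]
  rw [Real.dist_eq, div_eq_inv_mul]
  congr 1
  exact abs_of_nonneg h

lemma hasLaw_whiteNoise_increment (hB : IsPreBrownianReal B P) (n : ℕ) (h : C(unitInterval, ℝ))
    {s t : unitInterval} (hst : s ≤ t) :
    HasLaw (fun ω ↦ whiteNoise B n h ω t - whiteNoise B n h ω s)
      (gaussianReal (∫ u in Set.Ioc s t, h u) (incrementVar n s t)) P := by
  simp only [whiteNoise_increment n h _ hst]
  have := gaussianReal_const_add (gaussianReal_const_mul
    (hB.hasLaw_sub (unitInterval.toNNReal t) (unitInterval.toNNReal s)) (√(n : ℝ))⁻¹)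
    (∫ u in Set.Ioc s t, h u)
  simpa [incrementVar] using this

lemma monotone_toNNReal : Monotone unitInterval.toNNReal := fun _ _ h ↦ h

lemma iIndepFun_whiteNoise_increment (hB : IsPreBrownianReal B P) (n : ℕ)
    (h : C(unitInterval, ℝ)) {t : ℕ → unitInterval} (ht : Monotone t) :
    iIndepFun (fun i ω ↦ whiteNoise B n h ω (t (i + 1)) - whiteNoise B n h ω (t i)) P := by
  have h1 := (hB.hasIndepIncrements.nat (monotone_toNNReal.comp ht)).comp
    (fun i x ↦ (∫ u in Set.Ioc (t i) (t (i + 1)), h u) + (√(n : ℝ))⁻¹ * x)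
    (fun i ↦ by fun_prop)
  convert! h1 using 2 with i
  ext ω
  exact whiteNoise_increment n h ω (ht i.le_succ)

lemma map_whiteNoise_increment [IsProbabilityMeasure P] (hB : IsPreBrownianReal B P) (n : ℕ)
    (h : C(unitInterval, ℝ)) {t : ℕ → unitInterval} (ht : Monotone t) (d : ℕ) :
    P.map (fun ω (i : Fin d) ↦ whiteNoise B n h ω (t (i + 1)) - whiteNoise B n h ω (t i)) =
      Measure.pi fun i : Fin d ↦ gaussianReal (∫ u in Set.Ioc (t i) (t (i + 1)), h u)
        (incrementVar n (t i) (t (i + 1))) := by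
  have h1 := (iIndepFun_whiteNoise_increment hB n h ht).precomp
    (g := fun i : Fin d ↦ (i : ℕ)) Fin.val_injective
  rw [h1.map_fun_eq_pi_map fun i : Fin d ↦
    (hasLaw_whiteNoise_increment hB n h (ht (Nat.le_succ (i : ℕ)))).aemeasurable]
  congr 1
  ext1 i
  exact (hasLaw_whiteNoise_increment hB n h (ht (Nat.le_succ i))).map_eq

/-- The path starts at `0` only almost surely. Up to a null set, its values on a grid are thus
functions of the increments. -/
lemma whiteNoise_ae_eq_sum (hB : IsPreBrownianReal B P) (n : ℕ) (h : C(unitInterval, ℝ))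
    {t : ℕ → unitInterval} (h0 : t 0 = 0) :
    ∀ᵐ ω ∂P, ∀ j, whiteNoise B n h ω (t j) =
      ∑ i ∈ Finset.range j, (whiteNoise B n h ω (t (i + 1)) - whiteNoise B n h ω (t i)) := by
  filter_upwards [hB.eval_zero_ae_eq_zero] with ω hω j
  rw [Finset.sum_range_sub (fun i ↦ whiteNoise B n h ω (t i)), h0]
  have : whiteNoise B n h ω 0 = 0 := by
    have hz : volume (Set.Iic (0 : unitInterval)) = 0 := by simp
    simp [whiteNoise, hω, setIntegral_measure_zero _ hz]
  simp [this]

/-- The points of a finite set containing `0`, in increasing order. -/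
lemma exists_enumeration {J : Finset unitInterval} (h0 : 0 ∈ J) :
    ∃ (d : ℕ) (t : ℕ → unitInterval), Monotone t ∧ t 0 = 0 ∧
      (∀ i : Fin d, t i < t (i + 1)) ∧ (∀ x ∈ J, ∃ i ≤ d, t i = x) ∧
      ∀ x ∈ J, ∀ i : Fin d, x ≤ t i ∨ t (i + 1) ≤ x := by
  classical
  have hc : J.card = (J.card - 1) + 1 := (Nat.sub_add_cancel (Finset.card_pos.2 ⟨0, h0⟩)).symm
  set d := J.card - 1
  let e := J.orderEmbOfFin hc
  -- Constant from `d` on, to be monotone on all of `ℕ`.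
  let t : ℕ → unitInterval := fun i ↦ e ⟨min i d, by omega⟩
  have hmono : Monotone t := fun i j hij ↦ e.monotone (by
    simp only [Fin.mk_le_mk]; omega)
  have hsurj : ∀ x ∈ J, ∃ i ≤ d, t i = x := fun x hx ↦ by
    have : x ∈ Set.range e := by rw [Finset.range_orderEmbOfFin]; exact hx
    obtain ⟨i, rfl⟩ := this
    refine ⟨i, by omega, ?_⟩
    simp only [t]
    congr 1
    ext; simp; omega
  refine ⟨d, t, hmono, ?_, fun i ↦ ?_, hsurj, fun x hx i ↦ ?_⟩
  · obtain ⟨i, -, hi⟩ := hsurj 0 h0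
    exact le_antisymm (hi ▸ hmono (Nat.zero_le i)) unitInterval.nonneg'
  · refine e.strictMono ?_
    simp only [Fin.mk_lt_mk]; omega
  · obtain ⟨j, -, rfl⟩ := hsurj x hx
    rcases Nat.lt_or_ge i j with h | h
    · exact Or.inr (hmono h)
    · exact Or.inl (hmono h)

variable {ι : Type*} [Fintype ι]

/-- The variance of an increment is the cell length over `n`, and Cauchy–Schwarz on the cell
produces the same length, which cancels. So finitely many increments carry no more information than
`n ∫ h²`. -/
lemma sum_sq_setIntegral_div_le {n : ℕ} (hn : n ≠ 0) (h : C(unitInterval, ℝ))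
    {t : ℕ → unitInterval} (ht : Monotone t) {d : ℕ} (hlt : ∀ i : Fin d, t i < t (i + 1)) :
    ∑ i : Fin d, (∫ u in Set.Ioc (t i) (t (i + 1)), h u) ^ 2 /
      incrementVar n (t i) (t (i + 1)) ≤ n * ∫ u, h u ^ 2 := by
  have hi2 : Integrable (fun u ↦ h u ^ 2) volume := integrable_unitInterval (h.continuous.pow 2)
  calc ∑ i : Fin d, (∫ u in Set.Ioc (t i) (t (i + 1)), h u) ^ 2 /
      incrementVar n (t i) (t (i + 1))
      ≤ ∑ i : Fin d, n * ∫ u in Set.Ioc (t i) (t (i + 1)), h u ^ 2 := by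
        refine Finset.sum_le_sum fun i _ ↦ ?_
        have hl : (0 : ℝ) < t (i + 1) - t i := sub_pos.2 (hlt i)
        have hn' : (0 : ℝ) < n := by positivity
        have h1 := sq_setIntegral_le h.continuous (Set.Ioc (t i) (t (i + 1)))
        rw [Measure.real, unitInterval.volume_Ioc, ENNReal.toReal_ofReal hl.le] at h1
        rw [coe_incrementVar (hlt i).le, div_le_iff₀ (by positivity)]
        calc _ ≤ _ := h1
          _ = _ := by field_simp
    _ = n * ∑ i ∈ Finset.range d, ∫ u in Set.Ioc (t i) (t (i + 1)), h u ^ 2 := by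
        rw [← Finset.mul_sum, Finset.sum_range]
    _ ≤ n * ∫ u, h u ^ 2 := by
        gcongr
        rw [sum_setIntegral_Ioc ht hi2]
        exact setIntegral_le_integral hi2 (ae_of_all _ fun u ↦ sq_nonneg _)

/-- A cylinder event looks at finitely many times. Once `0` and all the end points `u k`, `w k` are
added to them, no cell of the grid lies in two of the intervals `[u k, w k]`. The vectors of mean
increments are then orthogonal, and `sum_pi_gaussianReal_le` applies. -/
lemma sum_whiteNoise_cylinder_le [IsProbabilityMeasure P] [Nonempty ι]
    (hB : IsPreBrownianReal B P) {n : ℕ} (hn : n ≠ 0) (h : ι → C(unitInterval, ℝ))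
    (u w : ι → unitInterval) (hsupp : ∀ k x, x < u k ∨ w k < x → h k x = 0)
    (hdisj : ∀ k l, k ≠ l → w k ≤ u l ∨ w l ≤ u k) {S : ℝ}
    (hS : ∀ k, n * ∫ x, h k x ^ 2 ≤ S) (I : Finset unitInterval) {A : Set (I → ℝ)}
    (hA : MeasurableSet A) :
    (∑ k, P.real (whiteNoise B n (h k) ⁻¹' cylinder I A)) / Fintype.card ι ≤
      P.real (whiteNoise B n 0 ⁻¹' cylinder I A) + √(Real.exp S / Fintype.card ι) := by
  classical
  obtain ⟨d, t, ht, ht0, hlt, hsurj, hcell⟩ := exists_enumeration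
    (J := insert 0 (I ∪ Finset.univ.image u ∪ Finset.univ.image w)) (Finset.mem_insert_self _ _)
  choose! idx hidx hidxt using hsurj
  -- Recovers the path at the times in `I` by summing the increments before them.
  let G : (Fin d → ℝ) → (I → ℝ) := fun x p ↦ ∑ i : Fin d, if (i : ℕ) < idx p then x i else 0
  have hG : Measurable G := measurable_pi_iff.2 fun p ↦ by
    refine Finset.measurable_sum _ fun i _ ↦ ?_
    split_ifs <;> fun_prop
  have hlaw : ∀ f : C(unitInterval, ℝ), P.real (whiteNoise B n f ⁻¹' cylinder I A) =
      (Measure.pi fun i : Fin d ↦ gaussianReal (∫ u in Set.Ioc (t i) (t (i + 1)), f u)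
        (incrementVar n (t i) (t (i + 1)))).real (G ⁻¹' A) := fun f ↦ by
    rw [← map_whiteNoise_increment hB n f ht d, map_measureReal_apply_of_aemeasurable]
    · refine measureReal_congr ?_
      filter_upwards [whiteNoise_ae_eq_sum hB n f ht0] with ω hω
      refine propext ?_
      change I.restrict (whiteNoise B n f ω) ∈ A ↔ _ ∈ A
      have : I.restrict (whiteNoise B n f ω) =
          G (fun i ↦ whiteNoise B n f ω (t (i + 1)) - whiteNoise B n f ω (t i)) := by
        ext p
        have hp : (p : unitInterval) ∈
            insert 0 (I ∪ Finset.univ.image u ∪ Finset.univ.image w) := by simp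
        have h1 : whiteNoise B n f ω p = whiteNoise B n f ω (t (idx p)) := by rw [hidxt p hp]
        simp only [Finset.restrict, G]
        rw [h1, hω, ← Finset.sum_range (f := fun i ↦ if i < idx p then
          whiteNoise B n f ω (t (i + 1)) - whiteNoise B n f ω (t i) else 0), ← Finset.sum_filter]
        congr 1
        ext i
        have := hidx p hp
        simp; omega
      rw [this]
    · exact aemeasurable_pi_lambda _ fun i ↦
        (hasLaw_whiteNoise_increment hB n f (ht (Nat.le_succ i))).aemeasurable
    · exact hG hA
  simp only [hlaw]
  have := sum_pi_gaussianReal_le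
    (a := fun k (i : Fin d) ↦ ∫ u in Set.Ioc (t i) (t (i + 1)), h k u)
    (v := fun i ↦ incrementVar n (t i) (t (i + 1))) (fun i h0 ↦ ?_) (S := S)
    (fun k l hkl i ↦ ?_) (fun k ↦ (sum_sq_setIntegral_div_le hn (h k) ht hlt).trans (hS k))
    (hG hA)
  · simpa using this
  · have h1 := coe_incrementVar (n := n) (hlt i).le
    rw [h0, NNReal.coe_zero, eq_comm, div_eq_zero_iff] at h1
    have := hlt i
    rcases h1 with h1 | h1
    · exact (sub_pos.2 (show (t i : ℝ) < t (i + 1) from hlt i)).ne' h1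
    · exact hn (by exact_mod_cast h1)
  · have hz : ∀ k, ¬ (u k ≤ t i ∧ t (i + 1) ≤ w k) →
        ∫ x in Set.Ioc (t i) (t (i + 1)), h k x = 0 := fun k hk ↦ by
      have hu : u k ∈ insert 0 (I ∪ Finset.univ.image u ∪ Finset.univ.image w) := by simp
      have hw : w k ∈ insert 0 (I ∪ Finset.univ.image u ∪ Finset.univ.image w) := by simp
      rcases hcell _ hu i with h1 | h1
      · rcases hcell _ hw i with h2 | h2
        · refine setIntegral_eq_zero_of_forall_eq_zero fun x hx ↦ hsupp k x (Or.inr ?_)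
          exact h2.trans_lt hx.1
        · exact absurd ⟨h1, h2⟩ hk
      -- If `t (i + 1) = u k`, then `h k` may be nonzero there; that end point is null.
      · rw [integral_Ioc_eq_integral_Ioo]
        exact setIntegral_eq_zero_of_forall_eq_zero fun x hx ↦
          hsupp k x (Or.inl (hx.2.trans_le h1))
    by_cases hk : u k ≤ t i ∧ t (i + 1) ≤ w k
    · by_cases hl : u l ≤ t i ∧ t (i + 1) ≤ w l
      · rcases hdisj k l hkl with h1 | h1
        · exact absurd ((hk.2.trans h1).trans hl.1) (not_le.2 (hlt i))
        · exact absurd ((hl.2.trans h1).trans hk.1) (not_le.2 (hlt i))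
      · rw [hz l hl, mul_zero]
    · rw [hz k hk, zero_mul]

/-! ### From cylinder events to all events of path space -/

/-- The law of the white noise path. -/
def whiteNoiseLaw (P : Measure Ω) (B : ℝ≥0 → Ω → ℝ) (n : ℕ) (h : C(unitInterval, ℝ)) :
    Measure (unitInterval → ℝ) :=
  Measure.map (whiteNoise (Ω := NullMeasurableSpace Ω P) B n h) P.completion

lemma whiteNoiseLaw_apply (hB : IsPreBrownianReal B P) (n : ℕ) (h : C(unitInterval, ℝ))
    {A : Set (unitInterval → ℝ)} (hA : MeasurableSet A) :
    whiteNoiseLaw P B n h A = P (whiteNoise B n h ⁻¹' A) := by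
  exact Measure.map_apply (nullMeasurable_whiteNoise hB n h).measurable' hA

instance [IsProbabilityMeasure P] (n : ℕ) (h : C(unitInterval, ℝ)) :
    IsFiniteMeasure (whiteNoiseLaw P B n h) := by
  have : IsFiniteMeasure P.completion := ⟨measure_lt_top P Set.univ⟩
  unfold whiteNoiseLaw
  infer_instance

/-- Perturbations of a drift with disjoint supports and squared signal-to-noise ratio at most `S`
cannot be told from the drift itself, up to `√(e^S / card ι)`, by any event. -/
theorem sum_whiteNoise_le [IsProbabilityMeasure P] [Nonempty ι]
    (hB : IsPreBrownianReal B P) {n : ℕ} (hn : n ≠ 0) (f : C(unitInterval, ℝ))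
    (h : ι → C(unitInterval, ℝ))
    (u w : ι → unitInterval) (hsupp : ∀ k x, x < u k ∨ w k < x → h k x = 0)
    (hdisj : ∀ k l, k ≠ l → w k ≤ u l ∨ w l ≤ u k) {S : ℝ}
    (hS : ∀ k, n * ∫ x, h k x ^ 2 ≤ S) {A : Set (unitInterval → ℝ)} (hA : MeasurableSet A) :
    (∑ k, P.real (whiteNoise B n (f + h k) ⁻¹' A)) / Fintype.card ι ≤
      P.real (whiteNoise B n f ⁻¹' A) + √(Real.exp S / Fintype.card ι) := by
  classical
  have main : ∀ {A : Set (unitInterval → ℝ)}, MeasurableSet A →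
      (∑ k, P.real (whiteNoise B n (h k) ⁻¹' A)) / Fintype.card ι ≤
      P.real (whiteNoise B n 0 ⁻¹' A) + √(Real.exp S / Fintype.card ι) := by
    intro A hA
    have hreal : ∀ g {A}, MeasurableSet A → P.real (whiteNoise B n g ⁻¹' A) =
        (whiteNoiseLaw P B n g).real A := fun g A hA ↦ by
      rw [Measure.real, Measure.real, whiteNoiseLaw_apply hB n g hA]
    refine le_of_forall_pos_le_add fun δ hδ ↦ ?_
    -- `μ` dominates all the laws involved, so a single cylinder `μ`-close to `A` is close for each
    -- of them.
    let μ : Measure (unitInterval → ℝ) :=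
      whiteNoiseLaw P B n 0 + ∑ k, whiteNoiseLaw P B n (h k)
    have hdense : μ.MeasureDense (measurableCylinders fun _ : unitInterval ↦ ℝ) :=
      Measure.MeasureDense.of_generateFrom_isSetAlgebra_finite _ isSetAlgebra_measurableCylinders
        generateFrom_measurableCylinders.symm
    obtain ⟨C, hC, hAC⟩ := hdense.approx A hA (measure_ne_top _ _) (δ / 2) (by positivity)
    have hCm := hdense.measurable C hC
    have hclose : ∀ g, whiteNoiseLaw P B n g ≤ μ →
        |(whiteNoiseLaw P B n g).real A - (whiteNoiseLaw P B n g).real C| ≤ δ / 2 :=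
      fun g hg ↦ by
        refine (abs_measureReal_sub_le_measureReal_symmDiff hA.nullMeasurableSet
          hCm.nullMeasurableSet).trans ?_
        exact ENNReal.toReal_le_of_le_ofReal (by positivity) ((hg _).trans hAC.le)
    have h0 := hclose 0 (Measure.le_add_right le_rfl)
    have hk : ∀ k, |(whiteNoiseLaw P B n (h k)).real A - (whiteNoiseLaw P B n (h k)).real C|
        ≤ δ / 2 := fun k ↦ hclose (h k) <| Measure.le_add_left
          (Finset.single_le_sum (f := fun k ↦ whiteNoiseLaw P B n (h k))
            (fun _ _ ↦ Measure.zero_le _) (Finset.mem_univ k))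
    obtain ⟨I, E, hE, rfl⟩ := (mem_measurableCylinders C).1 hC
    have hcyl := sum_whiteNoise_cylinder_le hB hn h u w hsupp hdisj hS I hE
    simp only [hreal _ hA, hreal _ hCm] at hcyl ⊢
    have hcard : (0 : ℝ) < Fintype.card ι := by exact_mod_cast Fintype.card_pos
    have hsum : (∑ k, (whiteNoiseLaw P B n (h k)).real A) / Fintype.card ι ≤
        (∑ k, (whiteNoiseLaw P B n (h k)).real (cylinder I E)) / Fintype.card ι + δ / 2 := by
      have : ∑ k, (whiteNoiseLaw P B n (h k)).real A ≤
          ∑ k, ((whiteNoiseLaw P B n (h k)).real (cylinder I E) + δ / 2) :=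
        Finset.sum_le_sum fun k _ ↦ by linarith [(abs_le.1 (hk k)).2]
      rw [Finset.sum_add_distrib, Finset.sum_const, Finset.card_univ, nsmul_eq_mul] at this
      rw [div_add' _ _ _ hcard.ne', div_le_div_iff_of_pos_right hcard]
      linarith
    linarith [(abs_le.1 h0).1]
  -- A common drift `f` only translates the path, and translation is measurable: the case `f = 0`
  -- suffices.
  have hshift : Measurable fun (y : unitInterval → ℝ) t ↦ y t + ∫ u in Set.Iic t, f u := by
    fun_prop
  have h1 := main (hshift hA)
  have h2 : ∀ g, whiteNoise B n g ⁻¹' ((fun (y : unitInterval → ℝ) t ↦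
      y t + ∫ u in Set.Iic t, f u) ⁻¹' A) = whiteNoise B n (f + g) ⁻¹' A := fun g ↦ by
    ext ω
    simp only [Set.mem_preimage, whiteNoise_add n f g ω]
  simpa only [h2, add_zero] using h1

end WhiteNoise

/-! ### Coefficient functionals and sup-norm bounds for wavelet sums -/

/-- The functional `f ↦ ∫ f b` on `C([0,1])`. -/
def pairing (b : C(unitInterval, ℝ)) : C(unitInterval, ℝ) →L[ℝ] ℝ :=
  LinearMap.mkContinuous
    { toFun := fun f ↦ ∫ x, f x * b x
      map_add' := fun f g ↦ by
        simp only [ContinuousMap.add_apply, add_mul]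
        exact integral_add (integrable_unitInterval (f.continuous.mul b.continuous))
          (integrable_unitInterval (g.continuous.mul b.continuous))
      map_smul' := fun c f ↦ by
        simp only [ContinuousMap.smul_apply, smul_eq_mul, mul_assoc, RingHom.id_apply]
        exact integral_const_mul c _ }
    ‖b‖ fun f ↦ by
      have h := norm_integral_le_of_norm_le_const (μ := (volume : Measure unitInterval))
        (f := fun x ↦ f x * b x) (C := ‖b‖ * ‖f‖) (ae_of_all _ fun x ↦ by
          rw [norm_mul, mul_comm]
          exact mul_le_mul (b.norm_coe_le_norm x) (f.norm_coe_le_norm x) (norm_nonneg _)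
            (norm_nonneg _))
      simpa using h

lemma card_filter_abs_sub_le (m K : ℕ) {y : ℝ} (hy : 0 ≤ y) :
    ((Finset.range m).filter fun k : ℕ ↦ |y - k| ≤ K).card ≤ 2 * K + 1 := by
  calc _ ≤ (Finset.Icc (⌊y⌋₊ - K) (⌊y⌋₊ + K)).card := by
        refine Finset.card_le_card fun k hk ↦ ?_
        obtain ⟨h1, h2⟩ := abs_le.1 (Finset.mem_filter.1 hk).2
        have h3 := Nat.lt_floor_add_one y
        have h4 := Nat.floor_le hy
        have h5 : k < ⌊y⌋₊ + 1 + K := by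
          have : (k : ℝ) < ⌊y⌋₊ + 1 + K := by linarith
          exact_mod_cast this
        have h6 : ⌊y⌋₊ ≤ k + K := by
          have : (⌊y⌋₊ : ℝ) ≤ k + K := by linarith
          exact_mod_cast this
        rw [Finset.mem_Icc]; omega
    _ ≤ 2 * K + 1 := by rw [Nat.card_Icc]; omega

lemma exists_bound_Ici {g : ℝ → ℝ} (hg : ContinuousOn g (Set.Ici 0)) {R : ℝ}
    (hR : ∀ x > R, g x = 0) : ∃ c, ∀ x, 0 ≤ x → |g x| ≤ c := by
  obtain ⟨c, hc⟩ := (isCompact_Icc (a := 0) (b := R)).exists_bound_of_continuousOn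
    (hg.mono fun x hx ↦ hx.1)
  refine ⟨max c 0, fun x hx ↦ ?_⟩
  rcases le_or_gt x R with h | h
  · exact (hc x ⟨hx, h⟩).trans (le_max_left _ _)
  · rw [hR x h, abs_zero]; exact le_max_right _ _

namespace IntervalWavelets

variable {W : IntervalWavelets}

lemma continuous_levelFn {g : ℝ → ℝ} {gL gR : ℕ → ℝ → ℝ} (hg : Continuous g)
    (hL : ∀ i < W.N, ContinuousOn (gL i) (Set.Ici 0))
    (hR : ∀ i < W.N, ContinuousOn (gR i) (Set.Ici 0)) {j k : ℕ} (hk : k < 2 ^ j) :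
    Continuous (W.levelFn g gL gR j k) := by
  unfold levelFn
  by_cases h1 : k < W.N
  · simp only [h1, if_true]
    refine continuous_const.mul ((hL k h1).comp_continuous (by fun_prop) fun x ↦ ?_)
    exact mul_nonneg (by positivity) x.2.1
  · simp only [h1, if_false]
    by_cases h2 : k + W.N < 2 ^ j
    · simp only [h2, if_true]
      unfold dilate
      fun_prop
    · simp only [h2, if_false]
      refine continuous_const.mul ((hR (2 ^ j - 1 - k) (by omega)).comp_continuous
        (by fun_prop) fun x ↦ ?_)
      exact mul_nonneg (by positivity) (sub_nonneg.2 x.2.2)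

/-- At any point at most `2N` boundary functions and `2K + 1` translates are nonzero, each at most
`D 2^{j/2}` with `D` independent of the level. This locality turns coefficient bounds into uniform
bounds. -/
lemma exists_sum_abs_levelFn_le {g : ℝ → ℝ} {gL gR : ℕ → ℝ → ℝ} (hg : Continuous g)
    (hsupp : Function.support g ⊆ Set.Icc (1 - (W.K : ℝ)) W.K)
    (hL : ∀ i < W.N, ContinuousOn (gL i) (Set.Ici 0))
    (hR : ∀ i < W.N, ContinuousOn (gR i) (Set.Ici 0)) {R : ℝ}
    (hLR : ∀ i < W.N, ∀ x > R, gL i x = 0 ∧ gR i x = 0) :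
    ∃ C > 0, ∀ (j : ℕ) (x : unitInterval),
      ∑ k : Fin (2 ^ j), |W.levelFn g gL gR j k x| ≤ C * (2 : ℝ) ^ ((j : ℝ) / 2) := by
  have hgsupp : ∀ y, g y ≠ 0 → |y| ≤ W.K := fun y hy ↦ by
    have := hsupp hy
    exact abs_le.2 ⟨by linarith [this.1], this.2⟩
  obtain ⟨c, hc⟩ : ∃ c, ∀ y, |g y| ≤ c := by
    obtain ⟨c, hc⟩ := (isCompact_Icc (a := 1 - (W.K : ℝ)) (b := W.K)).exists_bound_of_continuousOn
      hg.continuousOn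
    refine ⟨max c 0, fun y ↦ ?_⟩
    by_cases hy : g y = 0
    · rw [hy, abs_zero]; exact le_max_right _ _
    · exact (hc y (hsupp hy)).trans (le_max_left _ _)
  choose! cL hcL using fun i (hi : i < W.N) ↦
    exists_bound_Ici (hL i hi) fun x hx ↦ (hLR i hi x hx).1
  choose! cR hcR using fun i (hi : i < W.N) ↦
    exists_bound_Ici (hR i hi) fun x hx ↦ (hLR i hi x hx).2
  set D : ℝ := |c| + ∑ i ∈ Finset.range W.N, |cL i| + ∑ i ∈ Finset.range W.N, |cR i| with hD
  have hsL : 0 ≤ ∑ i ∈ Finset.range W.N, |cL i| := Finset.sum_nonneg fun _ _ ↦ abs_nonneg _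
  have hsR : 0 ≤ ∑ i ∈ Finset.range W.N, |cR i| := Finset.sum_nonneg fun _ _ ↦ abs_nonneg _
  have hD0 : 0 ≤ D := by positivity
  have hcD : ∀ y, |g y| ≤ D := fun y ↦ by linarith [hc y, le_abs_self c]
  have hLD : ∀ i < W.N, ∀ y, 0 ≤ y → |gL i y| ≤ D := fun i hi y hy ↦ by
    have := Finset.single_le_sum (f := fun i ↦ |cL i|) (fun _ _ ↦ abs_nonneg _)
      (Finset.mem_range.2 hi)
    linarith [hcL i hi y hy, le_abs_self (cL i), abs_nonneg c]
  have hRD : ∀ i < W.N, ∀ y, 0 ≤ y → |gR i y| ≤ D := fun i hi y hy ↦ by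
    have := Finset.single_le_sum (f := fun i ↦ |cR i|) (fun _ _ ↦ abs_nonneg _)
      (Finset.mem_range.2 hi)
    linarith [hcR i hi y hy, le_abs_self (cR i), abs_nonneg c]
  refine ⟨D * (W.N + W.N + (2 * W.K + 1)) + 1, by positivity, fun j x ↦ ?_⟩
  have hp : (0 : ℝ) < (2 : ℝ) ^ ((j : ℝ) / 2) := by positivity
  -- The indicators mark the left boundary indices, the right boundary indices, and the translates
  -- whose support can contain the point.
  have hpt : ∀ k < 2 ^ j, |W.levelFn g gL gR j k x| ≤ (2 : ℝ) ^ ((j : ℝ) / 2) * D *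
      ((if k < W.N then 1 else 0) + (if 2 ^ j ≤ k + W.N then 1 else 0) +
        if |(2 : ℝ) ^ j * x - k| ≤ W.K then 1 else 0) := fun k hk ↦ by
    have hq : 0 ≤ (2 : ℝ) ^ ((j : ℝ) / 2) * D := by positivity
    have key : ∀ (y : ℝ) (a b c : ℝ), 0 ≤ a → 0 ≤ b → 0 ≤ c → |y| ≤ D → (y ≠ 0 → 1 ≤ a + b + c) →
        |(2 : ℝ) ^ ((j : ℝ) / 2) * y| ≤ (2 : ℝ) ^ ((j : ℝ) / 2) * D * (a + b + c) := by
      intro y a b c ha hb hc hy h1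
      rw [abs_mul, abs_of_pos hp]
      by_cases h0 : y = 0
      · rw [h0]; simp; positivity
      · calc _ ≤ (2 : ℝ) ^ ((j : ℝ) / 2) * D * 1 := by rw [mul_one]; gcongr
          _ ≤ _ := by gcongr; exact h1 h0
    have i1 : (0 : ℝ) ≤ if k < W.N then 1 else 0 := by split_ifs <;> norm_num
    have i2 : (0 : ℝ) ≤ if 2 ^ j ≤ k + W.N then 1 else 0 := by split_ifs <;> norm_num
    have i3 : (0 : ℝ) ≤ if |(2 : ℝ) ^ j * x - k| ≤ W.K then 1 else 0 := by
      split_ifs <;> norm_num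
    by_cases h1 : k < W.N
    · rw [levelFn, if_pos h1]
      refine key _ _ _ _ i1 i2 i3 (hLD k h1 _ (mul_nonneg (by positivity) x.2.1)) fun _ ↦ ?_
      rw [if_pos h1]; linarith
    · by_cases h2 : k + W.N < 2 ^ j
      · rw [levelFn, if_neg h1, if_pos h2, dilate]
        refine key _ _ _ _ i1 i2 i3 (hcD _) fun h ↦ ?_
        have := hgsupp _ h
        simp only [zpow_natCast, Int.cast_natCast] at this
        rw [if_pos this]; linarith
      · rw [levelFn, if_neg h1, if_neg h2]
        refine key _ _ _ _ i1 i2 i3 (hRD _ (by omega) _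
          (mul_nonneg (by positivity) (sub_nonneg.2 x.2.2))) fun _ ↦ ?_
        rw [if_pos (not_lt.1 h2)]; linarith
  have c1 : ((Finset.range (2 ^ j)).filter fun k ↦ k < W.N).card ≤ W.N := by
    calc _ ≤ (Finset.range W.N).card := Finset.card_le_card fun k hk ↦
          Finset.mem_range.2 (Finset.mem_filter.1 hk).2
      _ = W.N := Finset.card_range _
  have c2 : ((Finset.range (2 ^ j)).filter fun k ↦ 2 ^ j ≤ k + W.N).card ≤ W.N := by
    calc _ ≤ (Finset.Ico (2 ^ j - W.N) (2 ^ j)).card := Finset.card_le_card fun k hk ↦ by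
          have := Finset.mem_filter.1 hk
          have h1 := Finset.mem_range.1 this.1
          rw [Finset.mem_Ico]; omega
      _ ≤ W.N := by rw [Nat.card_Ico]; omega
  have c3 := card_filter_abs_sub_le (2 ^ j) W.K (y := (2 : ℝ) ^ j * x)
    (mul_nonneg (by positivity) x.2.1)
  calc ∑ k : Fin (2 ^ j), |W.levelFn g gL gR j k x|
      ≤ ∑ k : Fin (2 ^ j), (2 : ℝ) ^ ((j : ℝ) / 2) * D *
      ((if (k : ℕ) < W.N then 1 else 0) + (if 2 ^ j ≤ (k : ℕ) + W.N then 1 else 0) +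
        if |(2 : ℝ) ^ j * x - (k : ℕ)| ≤ W.K then 1 else 0) :=
        Finset.sum_le_sum fun k _ ↦ hpt k k.2
    _ = (2 : ℝ) ^ ((j : ℝ) / 2) * D *
        (((Finset.range (2 ^ j)).filter fun k ↦ k < W.N).card +
        ((Finset.range (2 ^ j)).filter fun k ↦ 2 ^ j ≤ k + W.N).card +
        ((Finset.range (2 ^ j)).filter fun k : ℕ ↦ |(2 : ℝ) ^ j * x - k| ≤ W.K).card) := by
        rw [← Finset.sum_range (f := fun k : ℕ ↦ (2 : ℝ) ^ ((j : ℝ) / 2) * D *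
          ((if k < W.N then 1 else 0) + (if 2 ^ j ≤ k + W.N then 1 else 0) +
          if |(2 : ℝ) ^ j * x - k| ≤ W.K then 1 else 0)), ← Finset.mul_sum,
          Finset.sum_add_distrib, Finset.sum_add_distrib]
        simp only [Finset.sum_boole]
    _ ≤ (2 : ℝ) ^ ((j : ℝ) / 2) * D * (W.N + W.N + (2 * W.K + 1)) := by
        have c1' : (((Finset.range (2 ^ j)).filter fun k ↦ k < W.N).card : ℝ) ≤ W.N := by
          exact_mod_cast c1
        have c2' : (((Finset.range (2 ^ j)).filter fun k ↦ 2 ^ j ≤ k + W.N).card : ℝ) ≤ W.N := by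
          exact_mod_cast c2
        have c3' : (((Finset.range (2 ^ j)).filter
            fun k : ℕ ↦ |(2 : ℝ) ^ j * x - k| ≤ W.K).card : ℝ) ≤ 2 * W.K + 1 := by
          exact_mod_cast c3
        gcongr
    _ ≤ _ := by nlinarith

namespace IsWaveletBasis

lemma continuous_scalingFn (hW : W.IsWaveletBasis) (k : Fin (2 ^ W.j₀)) :
    Continuous (W.scalingFn k) :=
  continuous_levelFn hW.contDiff_scaling.continuous
    (fun i hi ↦ (hW.contDiff_boundary i hi).1.continuousOn)
    (fun i hi ↦ (hW.contDiff_boundary i hi).2.1.continuousOn) k.2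

lemma continuous_waveletFn (hW : W.IsWaveletBasis) (j : ℕ) (k : Fin (2 ^ j)) :
    Continuous (W.waveletFn j k) :=
  continuous_levelFn hW.continuous_wavelet
    (fun i hi ↦ (hW.contDiff_boundary i hi).2.2.1.continuousOn)
    (fun i hi ↦ (hW.contDiff_boundary i hi).2.2.2.continuousOn) k.2

/-- The scaling functions on `[0,1]` as elements of `C([0,1])`. -/
def scalingMap (hW : W.IsWaveletBasis) (k : Fin (2 ^ W.j₀)) : C(unitInterval, ℝ) :=
  ⟨W.scalingFn k, hW.continuous_scalingFn k⟩

/-- The wavelets on `[0,1]` as elements of `C([0,1])`. -/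
def waveletMap (hW : W.IsWaveletBasis) (j : ℕ) (k : Fin (2 ^ j)) : C(unitInterval, ℝ) :=
  ⟨W.waveletFn j k, hW.continuous_waveletFn j k⟩

end IsWaveletBasis
end IntervalWavelets

/-- Needed to pass from almost everywhere equality of continuous functions to equality. -/
lemma isOpenPosMeasure_unitInterval :
    (volume : Measure unitInterval).IsOpenPosMeasure where
  open_pos U hU hne h0 := by
    obtain ⟨x, hx⟩ := hne
    rcases lt_or_ge x 1 with h | h
    · obtain ⟨u, hu, hsub⟩ := exists_Ico_subset_of_mem_nhds (hU.mem_nhds hx) ⟨1, h⟩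
      have h1 := measure_mono_null hsub h0
      rw [unitInterval.volume_Ico, ENNReal.ofReal_eq_zero, sub_nonpos] at h1
      exact absurd h1 (not_le.2 hu)
    · have h01 : (0 : unitInterval) < x := lt_of_lt_of_le zero_lt_one h
      obtain ⟨u, hu, hsub⟩ := exists_Ioc_subset_of_mem_nhds (hU.mem_nhds hx) ⟨0, h01⟩
      have h1 := measure_mono_null hsub h0
      rw [unitInterval.volume_Ioc, ENNReal.ofReal_eq_zero, sub_nonpos] at h1
      exact absurd h1 (not_le.2 hu)

/-! ### Wavelet series with prescribed coefficients -/

namespace IntervalWavelets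

variable {W : IntervalWavelets}

lemma holderClass_iff {s M : ℝ} (hM : 0 ≤ M) (f : unitInterval → ℝ) :
    W.cNorm s f ≤ ENNReal.ofReal M ↔ (∀ k : Fin (2 ^ W.j₀), |W.alpha f k| ≤ M) ∧
      ∀ j, W.j₀ ≤ j → ∀ k : Fin (2 ^ j),
        (2 : ℝ) ^ ((j : ℝ) * (s + 1 / 2)) * |W.beta f j k| ≤ M := by
  simp only [cNorm, max_le_iff, iSup_le_iff, ENNReal.ofReal_le_ofReal_iff hM]
  exact Iff.and Iff.rfl ⟨fun h j hj k ↦ h ⟨j, hj⟩ k, fun h j k ↦ h j j.2 k⟩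

lemma le_cNorm (s : ℝ) (f : unitInterval → ℝ) {j : ℕ} (hj : W.j₀ ≤ j) (k : Fin (2 ^ j)) :
    ENNReal.ofReal ((2 : ℝ) ^ ((j : ℝ) * (s + 1 / 2)) * |W.beta f j k|) ≤ W.cNorm s f := by
  refine le_trans ?_ (le_max_right _ _)
  exact le_iSup_of_le (⟨j, hj⟩ : Set.Ici W.j₀) (le_iSup_of_le k le_rfl)

namespace IsWaveletBasis

lemma pairing_scalingMap (hW : W.IsWaveletBasis) (f : C(unitInterval, ℝ)) (k : Fin (2 ^ W.j₀)) :
    pairing (hW.scalingMap k) f = W.alpha f k := rfl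

lemma pairing_waveletMap (hW : W.IsWaveletBasis) (f : C(unitInterval, ℝ)) (j : ℕ)
    (k : Fin (2 ^ j)) : pairing (hW.waveletMap j k) f = W.beta f j k := rfl

lemma alpha_scalingMap (hW : W.IsWaveletBasis) (k l : Fin (2 ^ W.j₀)) :
    W.alpha (hW.scalingMap k) l = if k = l then 1 else 0 := by
  have := hW.orthonormal (.inl k) (.inl l)
  exact this.trans (by simp)

lemma alpha_waveletMap (hW : W.IsWaveletBasis) {j : ℕ} (hj : W.j₀ ≤ j) (k : Fin (2 ^ j))
    (l : Fin (2 ^ W.j₀)) : W.alpha (hW.waveletMap j k) l = 0 := by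
  have := hW.orthonormal (.inr ⟨⟨j, hj⟩, k⟩) (.inl l)
  exact this.trans (by simp)

lemma beta_scalingMap (hW : W.IsWaveletBasis) (k : Fin (2 ^ W.j₀)) {j : ℕ} (hj : W.j₀ ≤ j)
    (l : Fin (2 ^ j)) : W.beta (hW.scalingMap k) j l = 0 := by
  have := hW.orthonormal (.inl k) (.inr ⟨⟨j, hj⟩, l⟩)
  exact this.trans (by simp)

lemma beta_waveletMap (hW : W.IsWaveletBasis) {j : ℕ} (hj : W.j₀ ≤ j) (k l : Fin (2 ^ j)) :
    W.beta (hW.waveletMap j k) j l = if k = l then 1 else 0 := by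
  have := hW.orthonormal (.inr ⟨⟨j, hj⟩, k⟩) (.inr ⟨⟨j, hj⟩, l⟩)
  exact this.trans (by simp)

lemma beta_waveletMap_of_ne (hW : W.IsWaveletBasis) {i j : ℕ} (hi : W.j₀ ≤ i) (hj : W.j₀ ≤ j)
    (hij : i ≠ j) (k : Fin (2 ^ i)) (l : Fin (2 ^ j)) :
    W.beta (hW.waveletMap i k) j l = 0 := by
  have := hW.orthonormal (.inr ⟨⟨i, hi⟩, k⟩) (.inr ⟨⟨j, hj⟩, l⟩)
  rw [if_neg (fun h ↦ hij (congrArg Subtype.val (Sigma.mk.inj (Sum.inr.inj h)).1))] at this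
  exact this

/-- The part of a wavelet series at the resolution level `j`. -/
def levelMap (hW : W.IsWaveletBasis) (j : ℕ) (c : Fin (2 ^ j) → ℝ) : C(unitInterval, ℝ) :=
  ∑ k, c k • hW.waveletMap j k

lemma levelMap_apply (hW : W.IsWaveletBasis) (j : ℕ) (c : Fin (2 ^ j) → ℝ) (x : unitInterval) :
    hW.levelMap j c x = ∑ k, c k * W.waveletFn j k x := by
  simp only [levelMap, ContinuousMap.sum_apply, ContinuousMap.smul_apply, smul_eq_mul]
  rfl

lemma alpha_levelMap (hW : W.IsWaveletBasis) {j : ℕ} (hj : W.j₀ ≤ j) (c : Fin (2 ^ j) → ℝ)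
    (l : Fin (2 ^ W.j₀)) : W.alpha (hW.levelMap j c) l = 0 := by
  rw [← pairing_scalingMap hW, levelMap, map_sum]
  refine Finset.sum_eq_zero fun k _ ↦ ?_
  rw [map_smul, pairing_scalingMap, hW.alpha_waveletMap hj, smul_zero]

lemma beta_levelMap (hW : W.IsWaveletBasis) {j : ℕ} (hj : W.j₀ ≤ j) (c : Fin (2 ^ j) → ℝ)
    (l : Fin (2 ^ j)) : W.beta (hW.levelMap j c) j l = c l := by
  rw [← pairing_waveletMap hW, levelMap, map_sum]
  simp only [map_smul, pairing_waveletMap, hW.beta_waveletMap hj]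
  simp

lemma beta_levelMap_of_ne (hW : W.IsWaveletBasis) {i j : ℕ} (hi : W.j₀ ≤ i) (hj : W.j₀ ≤ j)
    (hij : i ≠ j) (c : Fin (2 ^ i) → ℝ) (l : Fin (2 ^ j)) :
    W.beta (hW.levelMap i c) j l = 0 := by
  rw [← pairing_waveletMap hW, levelMap, map_sum]
  refine Finset.sum_eq_zero fun k _ ↦ ?_
  rw [map_smul, pairing_waveletMap, hW.beta_waveletMap_of_ne hi hj hij, smul_zero]

/-- The part of a wavelet series given by the scaling functions. -/
def scalingLevelMap (hW : W.IsWaveletBasis) (c : Fin (2 ^ W.j₀) → ℝ) : C(unitInterval, ℝ) :=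
  ∑ k, c k • hW.scalingMap k

lemma scalingLevelMap_apply (hW : W.IsWaveletBasis) (c : Fin (2 ^ W.j₀) → ℝ)
    (x : unitInterval) : hW.scalingLevelMap c x = ∑ k, c k * W.scalingFn k x := by
  simp only [scalingLevelMap, ContinuousMap.sum_apply, ContinuousMap.smul_apply, smul_eq_mul]
  rfl

lemma alpha_scalingLevelMap (hW : W.IsWaveletBasis) (c : Fin (2 ^ W.j₀) → ℝ)
    (l : Fin (2 ^ W.j₀)) : W.alpha (hW.scalingLevelMap c) l = c l := by
  rw [← pairing_scalingMap hW, scalingLevelMap, map_sum]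
  simp only [map_smul, pairing_scalingMap, hW.alpha_scalingMap]
  simp

lemma beta_scalingLevelMap (hW : W.IsWaveletBasis) (c : Fin (2 ^ W.j₀) → ℝ) {j : ℕ}
    (hj : W.j₀ ≤ j) (l : Fin (2 ^ j)) : W.beta (hW.scalingLevelMap c) j l = 0 := by
  rw [← pairing_waveletMap hW, scalingLevelMap, map_sum]
  refine Finset.sum_eq_zero fun k _ ↦ ?_
  rw [map_smul, pairing_waveletMap, hW.beta_scalingMap k hj, smul_zero]

lemma exists_sum_abs_waveletFn_le (hW : W.IsWaveletBasis) :
    ∃ C > 0, ∀ (j : ℕ) (x : unitInterval),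
      ∑ k : Fin (2 ^ j), |W.waveletFn j k x| ≤ C * (2 : ℝ) ^ ((j : ℝ) / 2) := by
  obtain ⟨R, hR⟩ := hW.support_boundary
  exact exists_sum_abs_levelFn_le hW.continuous_wavelet hW.support_wavelet
    (fun i hi ↦ (hW.contDiff_boundary i hi).2.2.1.continuousOn)
    (fun i hi ↦ (hW.contDiff_boundary i hi).2.2.2.continuousOn)
    (fun i hi x hx ↦ (hR i hi x hx).2.2)

lemma exists_sum_abs_scalingFn_le (hW : W.IsWaveletBasis) :
    ∃ C > 0, ∀ x : unitInterval,
      ∑ k : Fin (2 ^ W.j₀), |W.scalingFn k x| ≤ C * (2 : ℝ) ^ ((W.j₀ : ℝ) / 2) := by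
  obtain ⟨R, hR⟩ := hW.support_boundary
  obtain ⟨C, hC, h⟩ := exists_sum_abs_levelFn_le (W := W) hW.contDiff_scaling.continuous
    hW.support_scaling
    (fun i hi ↦ (hW.contDiff_boundary i hi).1.continuousOn)
    (fun i hi ↦ (hW.contDiff_boundary i hi).2.1.continuousOn)
    (fun i hi x hx ↦ ⟨(hR i hi x hx).1, (hR i hi x hx).2.1⟩)
  exact ⟨C, hC, h W.j₀⟩

lemma abs_sum_mul_le {ι : Type*} [Fintype ι] {c b : ι → ℝ} {A D : ℝ} (hA : 0 ≤ A)
    (hc : ∀ k, |c k| ≤ A) (hb : ∑ k, |b k| ≤ D) : |∑ k, c k * b k| ≤ A * D :=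
  calc |∑ k, c k * b k| ≤ ∑ k, |c k * b k| := Finset.abs_sum_le_sum_abs _ _
    _ ≤ ∑ k, A * |b k| := Finset.sum_le_sum fun k _ ↦ by
        rw [abs_mul]; exact mul_le_mul_of_nonneg_right (hc k) (abs_nonneg _)
    _ ≤ A * D := by rw [← Finset.mul_sum]; gcongr

/-- Wavelet series with coefficients of size `A 2^{-j(s+1/2)}` converge uniformly, with
remainder of order `2^{-js}`. -/
theorem exists_series (hW : W.IsWaveletBasis) {s : ℝ} (hs : 0 < s) :
    ∃ C > 0, ∀ (A : ℝ) (c : (j : ℕ) → Fin (2 ^ j) → ℝ), 0 ≤ A →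
      (∀ j, W.j₀ ≤ j → ∀ k, (2 : ℝ) ^ ((j : ℝ) * (s + 1 / 2)) * |c j k| ≤ A) →
      ∃ F : C(unitInterval, ℝ), (∀ k : Fin (2 ^ W.j₀), W.alpha F k = 0) ∧
        (∀ j, W.j₀ ≤ j → ∀ k : Fin (2 ^ j), W.beta F j k = c j k) ∧
        ∀ J (x : unitInterval), |F x - ∑ j ∈ Finset.Icc W.j₀ J, hW.levelMap j (c j) x| ≤
          A * C * (2 : ℝ) ^ (-(J : ℝ) * s) := by
  obtain ⟨D, hD, hsum⟩ := hW.exists_sum_abs_waveletFn_le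
  set q : ℝ := (2 : ℝ) ^ (-s) with hq
  have hq0 : 0 < q := by positivity
  have hq1 : q < 1 := Real.rpow_lt_one_of_one_lt_of_neg (by norm_num) (by linarith)
  have hqpow : ∀ j : ℕ, q ^ j = (2 : ℝ) ^ (-(j : ℝ) * s) := fun j ↦ by
    rw [hq, ← Real.rpow_natCast, ← Real.rpow_mul (by norm_num)]; congr 1; ring
  refine ⟨D * q / (1 - q), div_pos (by positivity) (by linarith), fun A c hA hc ↦ ?_⟩
  let g : ℕ → C(unitInterval, ℝ) := fun j ↦ if W.j₀ ≤ j then hW.levelMap j (c j) else 0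
  -- Coefficients of size `2^{-j(s+1/2)}` against basis functions summing to `2^{j/2}` leave
  -- `2^{-js} = q^j`.
  have hg : ∀ j, ‖g j‖ ≤ A * D * q ^ j := fun j ↦ by
    simp only [g]
    split_ifs with hj
    · refine (ContinuousMap.norm_le _ (by positivity)).2 fun x ↦ ?_
      rw [levelMap_apply, Real.norm_eq_abs]
      have h2 : (0 : ℝ) < (2 : ℝ) ^ ((j : ℝ) * (s + 1 / 2)) := by positivity
      refine (abs_sum_mul_le (A := A * (2 : ℝ) ^ (-((j : ℝ) * (s + 1 / 2)))) (by positivity)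
        (fun k ↦ ?_) (hsum j x)).trans (le_of_eq ?_)
      · rw [Real.rpow_neg (by norm_num), ← div_eq_mul_inv, le_div_iff₀ h2, mul_comm]
        exact hc j hj k
      · rw [hqpow, mul_mul_mul_comm, ← Real.rpow_add (by norm_num)]
        congr 2; ring
    · rw [norm_zero]; positivity
  have hgs : Summable g := Summable.of_norm_bounded
    ((summable_geometric_of_lt_one hq0.le hq1).mul_left (A * D)) hg
  have hF := hgs.hasSum
  refine ⟨∑' j, g j, fun k ↦ ?_, fun j hj k ↦ ?_, fun J x ↦ ?_⟩
  -- Coefficients are continuous functionals for the uniform norm, so they are taken term by term.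
  · rw [← pairing_scalingMap hW, (pairing _).map_tsum hgs]
    have : ∀ j, pairing (hW.scalingMap k) (g j) = 0 := fun j ↦ by
      simp only [g]
      split_ifs with hj
      · rw [pairing_scalingMap, hW.alpha_levelMap hj]
      · exact map_zero _
    simp [this]
  · rw [← pairing_waveletMap hW, (pairing _).map_tsum hgs, tsum_eq_single j]
    · simp only [g]
      rw [if_pos hj, pairing_waveletMap, hW.beta_levelMap hj]
    · intro i hij
      simp only [g]
      split_ifs with hi
      · rw [pairing_waveletMap, hW.beta_levelMap_of_ne hi hj hij]
      · exact map_zero _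
  -- Removing levels `0` to `J` leaves a tail starting at `q^(J+1)`, whence the factor `q` in the
  -- constant.
  · have h1 := norm_sub_le_of_geometric_bound_of_hasSum hq1 hg hF (J + 1)
    rw [norm_sub_rev] at h1
    have h2 := (ContinuousMap.norm_coe_le_norm _ x).trans h1
    have h3 : ∑ j ∈ Finset.range (J + 1), g j =
        ∑ j ∈ Finset.Icc W.j₀ J, hW.levelMap j (c j) := by
      rw [← Finset.sum_filter]
      congr 1
      ext i; simp; omega
    rw [h3, ContinuousMap.sub_apply, ContinuousMap.sum_apply, Real.norm_eq_abs] at h2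
    refine h2.trans (le_of_eq ?_)
    rw [← hqpow, pow_succ]; field_simp

/-- A function in `C^s(M)` is approximated by its truncated wavelet series. -/
theorem exists_approx (hW : W.IsWaveletBasis) {s : ℝ} (hs : 0 < s) :
    ∃ C > 0, ∀ (M : ℝ) (f : C(unitInterval, ℝ)), 0 ≤ M → f ∈ W.holderClass s M →
      ∀ J (x : unitInterval), |f x - (hW.scalingLevelMap (fun k ↦ W.alpha f k) x +
        ∑ j ∈ Finset.Icc W.j₀ J, hW.levelMap j (fun k ↦ W.beta f j k) x)| ≤
          M * C * (2 : ℝ) ^ (-(J : ℝ) * s) := by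
  obtain ⟨C, hC, h⟩ := hW.exists_series hs
  refine ⟨C, hC, fun M f hM hf J x ↦ ?_⟩
  obtain ⟨h1, h2⟩ := (holderClass_iff hM _).1 hf
  obtain ⟨F, hFa, hFb, hF⟩ := h M (fun j k ↦ W.beta f j k) hM h2
  -- All coefficients of this continuous difference vanish, so completeness makes it zero almost
  -- everywhere, hence everywhere.
  have hz : f - (hW.scalingLevelMap (fun k ↦ W.alpha f k) + F) = 0 := by
    set d := f - (hW.scalingLevelMap (fun k ↦ W.alpha f k) + F) with hd
    have h0 := hW.complete d (d.continuous.memLp_of_hasCompactSupport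
      (HasCompactSupport.of_compactSpace _)) fun a ↦ by
        rcases a with k | ⟨⟨j, hj⟩, k⟩
        · change pairing (hW.scalingMap k) d = 0
          rw [hd, map_sub, map_add, pairing_scalingMap, pairing_scalingMap, pairing_scalingMap,
            hW.alpha_scalingLevelMap, hFa]
          ring
        · change pairing (hW.waveletMap j k) d = 0
          rw [hd, map_sub, map_add, pairing_waveletMap, pairing_waveletMap, pairing_waveletMap,
            hW.beta_scalingLevelMap _ hj, hFb j hj]
          ring
    ext x
    have := isOpenPosMeasure_unitInterval
    exact congrFun ((d.continuous.ae_eq_iff_eq volume continuous_zero).1 h0) x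
  have hfx : f x = hW.scalingLevelMap (fun k ↦ W.alpha f k) x + F x := by
    have := congrArg (fun g : C(unitInterval, ℝ) ↦ g x) hz
    simp only [ContinuousMap.sub_apply, ContinuousMap.add_apply, ContinuousMap.zero_apply] at this
    linarith
  rw [hfx]
  have := hF J x
  rwa [add_sub_add_left_eq_sub]

lemma exists_abs_le (hW : W.IsWaveletBasis) {s : ℝ} (hs : 0 < s) {M : ℝ} (hM : 0 ≤ M) :
    ∃ C > 0, ∀ f ∈ W.holderClass s M, ∀ x, |f x| ≤ C := by
  obtain ⟨C, hC, h⟩ := hW.exists_approx hs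
  obtain ⟨D, hD, hsum⟩ := hW.exists_sum_abs_scalingFn_le
  refine ⟨M * C + M * (D * (2 : ℝ) ^ ((W.j₀ : ℝ) / 2)) + 1, by positivity, fun f hf x ↦ ?_⟩
  have h1 := h M f hM hf 0 x
  -- At `J = 0` no wavelet level is left, because `0 < j₀`.
  rw [Finset.Icc_eq_empty (by have := hW.level_pos; omega), Finset.sum_empty,
    scalingLevelMap_apply] at h1
  have h2 := abs_sum_mul_le hM ((holderClass_iff hM _).1 hf).1 (hsum x)
  simp only [CharP.cast_eq_zero, neg_zero, zero_mul, Real.rpow_zero, mul_one, add_zero] at h1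
  have h3 := abs_sub_abs_le_abs_sub (f x) (∑ k : Fin (2 ^ W.j₀), W.alpha f k * W.scalingFn k x)
  linarith

/-! ### Self-similar functions with one prescribed coefficient per level -/

lemma beta_truncation (hW : W.IsWaveletBasis) (f : C(unitInterval, ℝ)) {i l : ℕ}
    (hi : W.j₀ ≤ i) (hil : i ≤ l) (k : Fin (2 ^ i)) :
    W.beta (W.truncation f i l) i k = W.beta f i k := by
  have h : W.truncation f i l = ⇑((if i = W.j₀ then
      hW.scalingLevelMap (fun k ↦ W.alpha f k) else 0) +
      ∑ j ∈ Finset.Icc i l, hW.levelMap j (fun k ↦ W.beta f j k)) := by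
    ext x
    simp only [truncation, ContinuousMap.add_apply, ContinuousMap.sum_apply, levelMap_apply]
    split_ifs
    · rw [scalingLevelMap_apply]
    · simp
  rw [h, ← pairing_waveletMap hW, map_add, map_sum, Finset.sum_eq_single i]
  · rw [pairing_waveletMap _ (hW.levelMap i _), hW.beta_levelMap hi]
    split_ifs with h0
    · rw [pairing_waveletMap, hW.beta_scalingLevelMap _ hi, zero_add]
    · rw [map_zero, zero_add]
  · intro j hj hne
    rw [pairing_waveletMap, hW.beta_levelMap_of_ne (hi.trans (Finset.mem_Icc.1 hj).1) hi hne]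
  · intro hn
    exact absurd (Finset.mem_Icc.2 ⟨le_rfl, hil⟩) hn

/-- The index `0` at each level. -/
def zeroIndex (j : ℕ) : Fin (2 ^ j) := ⟨0, by positivity⟩

/-- The truncation `f_{j,ρj}` contains level `j` since `ρ ≥ 1`, and its coefficient of index `0`
there already gives norm at least `M ≥ ε M`. -/
lemma mem_selfSimilarClass (hW : W.IsWaveletBasis) {smax ε s M : ℝ} {ρ : ℕ} (hε1 : ε < 1)
    (hρ : 1 ≤ ρ) (hM : 0 ≤ M) {f : C(unitInterval, ℝ)}
    (hα : ∀ k : Fin (2 ^ W.j₀), W.alpha f k = 0)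
    (hβ : ∀ j, W.j₀ ≤ j → ∀ k : Fin (2 ^ j),
      (2 : ℝ) ^ ((j : ℝ) * (s + 1 / 2)) * |W.beta f j k| ≤ M)
    (hβ0 : ∀ j, W.j₀ ≤ j →
      (2 : ℝ) ^ ((j : ℝ) * (s + 1 / 2)) * |W.beta f j (zeroIndex j)| = M) :
    f ∈ W.selfSimilarClass smax ε ρ s M := by
  refine ⟨(holderClass_iff hM _).2 ⟨fun k ↦ by rw [hα, abs_zero]; exact hM, hβ⟩,
    fun j hj _ ↦ ?_⟩
  refine le_trans ?_ (le_cNorm s _ hj (zeroIndex j))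
  rw [hW.beta_truncation f hj (Nat.le_mul_of_pos_left j hρ), hβ0 j hj]
  exact ENNReal.ofReal_le_ofReal (by nlinarith)

/-- A self-similar function whose wavelet coefficients vanish off the index `0` at each level. -/
lemma exists_base (hW : W.IsWaveletBasis) {s M : ℝ} (hs : 0 < s) (hM : 0 ≤ M) :
    ∃ f : C(unitInterval, ℝ), (∀ k : Fin (2 ^ W.j₀), W.alpha f k = 0) ∧
      ∀ j, W.j₀ ≤ j → ∀ k : Fin (2 ^ j), W.beta f j k =
        if (k : ℕ) = 0 then M * (2 : ℝ) ^ (-((j : ℝ) * (s + 1 / 2))) else 0 := by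
  obtain ⟨C, -, h⟩ := hW.exists_series hs
  obtain ⟨F, h1, h2, -⟩ := h M
    (fun j k ↦ if (k : ℕ) = 0 then M * (2 : ℝ) ^ (-((j : ℝ) * (s + 1 / 2))) else 0) hM
    fun j hj k ↦ by
      split_ifs
      · rw [abs_of_nonneg (by positivity), mul_left_comm, ← Real.rpow_add (by norm_num)]
        simp
      · simpa using hM
  exact ⟨F, h1, h2⟩

/-- The perturbation leaves every coefficient of index `0` alone and replaces a zero coefficient by
`δ`. Self-similarity therefore survives, and the Hölder bound only asks that `δ` be small enough for
its level. -/
lemma base_add_mem (hW : W.IsWaveletBasis) {smax ε s M : ℝ} {ρ : ℕ} (hε1 : ε < 1)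
    (hρ : 1 ≤ ρ) (hM : 0 ≤ M) {f : C(unitInterval, ℝ)}
    (hα : ∀ k : Fin (2 ^ W.j₀), W.alpha f k = 0)
    (hβ : ∀ j, W.j₀ ≤ j → ∀ k : Fin (2 ^ j), W.beta f j k =
        if (k : ℕ) = 0 then M * (2 : ℝ) ^ (-((j : ℝ) * (s + 1 / 2))) else 0)
    {j : ℕ} (hj : W.j₀ ≤ j) {k : Fin (2 ^ j)} (hk : (k : ℕ) ≠ 0) {δ : ℝ}
    (hδ : (2 : ℝ) ^ ((j : ℝ) * (s + 1 / 2)) * |δ| ≤ M) :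
    f + δ • hW.waveletMap j k ∈ W.selfSimilarClass smax ε ρ s M := by
  have hc : ∀ i : ℕ, (2 : ℝ) ^ ((i : ℝ) * (s + 1 / 2)) *
      |M * (2 : ℝ) ^ (-((i : ℝ) * (s + 1 / 2)))| = M := fun i ↦ by
    rw [abs_of_nonneg (by positivity), mul_left_comm, ← Real.rpow_add (by norm_num)]
    simp
  have hb : ∀ i (l : Fin (2 ^ i)), W.beta (f + δ • hW.waveletMap j k : C(unitInterval, ℝ)) i l =
      W.beta f i l + δ * W.beta (hW.waveletMap j k) i l := fun i l ↦ by
    rw [← pairing_waveletMap hW, map_add, map_smul]; rfl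
  have hb0 : ∀ i, W.j₀ ≤ i → ∀ l : Fin (2 ^ i), (l : ℕ) = 0 →
      W.beta (hW.waveletMap j k) i l = 0 := fun i hi l hl ↦ by
    by_cases hij : j = i
    · subst hij
      rw [hW.beta_waveletMap hj, if_neg]
      rintro rfl
      exact hk hl
    · exact hW.beta_waveletMap_of_ne hj hi hij _ _
  refine hW.mem_selfSimilarClass hε1 hρ hM (fun l ↦ ?_) (fun i hi l ↦ ?_) fun i hi ↦ ?_
  · have : W.alpha (f + δ • hW.waveletMap j k : C(unitInterval, ℝ)) l =
      W.alpha f l + δ * W.alpha (hW.waveletMap j k) l := by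
      rw [← pairing_scalingMap hW, map_add, map_smul]; rfl
    rw [this, hα, hW.alpha_waveletMap hj]; ring
  · rw [hb, hβ i hi]
    split_ifs with hl
    · rw [hb0 i hi l hl, mul_zero, add_zero, hc]
    · rw [zero_add]
      by_cases hij : j = i
      · subst hij
        rw [hW.beta_waveletMap hj]
        split_ifs
        · rwa [mul_one]
        · simpa using hM
      · rw [hW.beta_waveletMap_of_ne hj hi hij]; simpa using hM
  · rw [hb, hβ i hi, hb0 i hi _ rfl, mul_zero, add_zero,
      if_pos (show ((zeroIndex i : Fin (2 ^ i)) : ℕ) = 0 from rfl), hc]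

end IsWaveletBasis
end IntervalWavelets

/-! ### From indistinguishable drifts to estimation error -/

section Testing

variable {Ω : Type*} [MeasurableSpace Ω] {P : Measure Ω} {B : ℝ≥0 → Ω → ℝ}

/-- If a drift and its perturbations with disjoint supports are hard to tell apart, then no
estimator is close to all of them with large probability. -/
theorem exists_estimator_error [IsProbabilityMeasure P] {ι : Type*} [Fintype ι] [Nonempty ι]
    (hB : IsPreBrownianReal B P) {n : ℕ} (hn : n ≠ 0) (f : C(unitInterval, ℝ))
    (h : ι → C(unitInterval, ℝ))
    (u w : ι → unitInterval) (hsupp : ∀ k x, x < u k ∨ w k < x → h k x = 0)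
    (hdisj : ∀ k l, k ≠ l → w k ≤ u l ∨ w l ≤ u k) {S : ℝ}
    (hS : ∀ k, n * ∫ x, h k x ^ 2 ≤ S) {r : ℝ} (x : ι → unitInterval)
    (hr : ∀ k, 2 * r ≤ |h k (x k)|) {T : (unitInterval → ℝ) → unitInterval → ℝ}
    (hT : IsEstimator T) :
    ∃ g, (g = f ∨ ∃ k, g = f + h k) ∧ (1 - √(Real.exp S / Fintype.card ι)) / 2 ≤
      P.real {ω | ∃ k, r ≤ |T (whiteNoise B n g ω) (x k) - g (x k)|} := by
  by_contra! hcon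
  set q := (1 - √(Real.exp S / Fintype.card ι)) / 2 with hq
  -- Under `f + h k` this event is likely if the estimator is good. Under `f` it forces an error
  -- larger than `r` at some `x k`, since `|h k (x k)| ≥ 2 r`.
  let A : Set (unitInterval → ℝ) := ⋃ k, {y | |T y (x k) - (f + h k) (x k)| < r}
  have hA : MeasurableSet A := MeasurableSet.iUnion fun k ↦
    measurableSet_lt ((hT (x k)).sub_const _).abs measurable_const
  have h1 := sum_whiteNoise_le hB hn f h u w hsupp hdisj hS hA
  have h0 : P.real (whiteNoise B n f ⁻¹' A) < q := by
    refine lt_of_le_of_lt (measureReal_mono fun ω hω ↦ ?_) (hcon f (Or.inl rfl))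
    obtain ⟨k, hk⟩ := Set.mem_iUnion.1 hω
    refine ⟨k, ?_⟩
    have hk' : |T (whiteNoise B n f ω) (x k) - (f + h k) (x k)| < r := hk
    have h2 := abs_sub_abs_le_abs_sub (h k (x k)) (T (whiteNoise B n f ω) (x k) - f (x k))
    rw [ContinuousMap.add_apply, abs_sub_comm] at hk'
    have h3 : h k (x k) - (T (whiteNoise B n f ω) (x k) - f (x k)) =
      f (x k) + h k (x k) - T (whiteNoise B n f ω) (x k) := by ring
    rw [h3] at h2
    linarith [hr k]
  have hk : ∀ k, 1 - q ≤ P.real (whiteNoise B n (f + h k) ⁻¹' A) := fun k ↦ by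
    have h2 : P.real (whiteNoise B n (f + h k) ⁻¹' Aᶜ) < q := by
      refine lt_of_le_of_lt (measureReal_mono fun ω hω ↦ ?_) (hcon (f + h k) (Or.inr ⟨k, rfl⟩))
      refine ⟨k, le_of_not_gt fun hlt ↦ hω (Set.mem_iUnion.2 ⟨k, hlt⟩)⟩
    have h3 := measureReal_union_le (μ := P) (whiteNoise B n (f + h k) ⁻¹' A)
      (whiteNoise B n (f + h k) ⁻¹' Aᶜ)
    rw [Set.preimage_compl, Set.union_compl_self, probReal_univ] at h3
    rw [Set.preimage_compl] at h2
    linarith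
  have hcard : (0 : ℝ) < Fintype.card ι := by exact_mod_cast Fintype.card_pos
  have h4 : 1 - q ≤ (∑ k, P.real (whiteNoise B n (f + h k) ⁻¹' A)) / Fintype.card ι := by
    rw [le_div_iff₀ hcard]
    have := Finset.sum_le_sum fun k (_ : k ∈ Finset.univ) ↦ hk k
    rw [Finset.sum_const, Finset.card_univ, nsmul_eq_mul] at this
    linarith
  -- The mean over `k` lies between `1 - q` and `P_f(A) + √(e^S / card ι) < q + √(e^S / card ι)`,
  -- which equals `1 - q`: a contradiction.
  linarith

end Testing

/-! ### Lower bound at a fixed sample size -/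

namespace IntervalWavelets

variable {W : IntervalWavelets}

lemma waveletFn_of_interior {j k : ℕ} (h1 : W.N ≤ k) (h2 : k + W.N < 2 ^ j)
    (x : unitInterval) :
    W.waveletFn j k x = (2 : ℝ) ^ ((j : ℝ) / 2) * W.ψ ((2 : ℝ) ^ j * x - k) := by
  rw [waveletFn, levelFn, if_neg (not_lt.2 h1), if_pos h2, dilate]
  simp

namespace IsWaveletBasis

lemma exists_wavelet_ne_zero (hW : W.IsWaveletBasis) : ∃ y, W.ψ y ≠ 0 := by
  by_contra! h
  have := hW.isOrthonormalMRA.orthonormal_wavelet 0 0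
  simp [h] at this

lemma wavelet_support (hW : W.IsWaveletBasis) {y : ℝ} (hy : W.ψ y ≠ 0) :
    1 - (W.K : ℝ) ≤ y ∧ y ≤ W.K := hW.support_wavelet hy

lemma integral_sq_waveletMap (hW : W.IsWaveletBasis) {j : ℕ} (hj : W.j₀ ≤ j) (k : Fin (2 ^ j)) :
    ∫ x, hW.waveletMap j k x ^ 2 = 1 := by
  have h := hW.beta_waveletMap hj k k
  rw [if_pos rfl] at h
  simp only [sq]
  exact h

end IsWaveletBasis

/-- The points `k / 2^j`. -/
def dyadic (j k : ℕ) (hk : k ≤ 2 ^ j) : unitInterval :=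
  ⟨k / 2 ^ j, by positivity, div_le_one_of_le₀ (by exact_mod_cast hk) (by positivity)⟩

/-- Lower bound at a fixed sample size, with perturbations at level `j`. -/
theorem IsWaveletBasis.exists_error (hW : W.IsWaveletBasis) {Ω : Type*} [MeasurableSpace Ω]
    {P : Measure Ω} {B : ℝ≥0 → Ω → ℝ} [IsProbabilityMeasure P] (hB : IsPreBrownianReal B P)
    {smax ε s M : ℝ} {ρ : ℕ} (hε1 : ε < 1) (hρ : 1 ≤ ρ) (hs : 0 < s) (hM : 0 ≤ M) {y : ℝ}
    (hy : W.ψ y ≠ 0) {n : ℕ} (hn : n ≠ 0) {j m : ℕ} (hj : W.j₀ ≤ j) (hm : 0 < m)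
    (hmj : 2 * (W.K + W.N) * (m + 1) ≤ 2 ^ j) {δ : ℝ} (hδ0 : 0 ≤ δ)
    (hδ : (2 : ℝ) ^ ((j : ℝ) * (s + 1 / 2)) * δ ≤ M)
    {T : (unitInterval → ℝ) → unitInterval → ℝ} (hT : IsEstimator T) :
    ∃ f ∈ W.selfSimilarClass smax ε ρ s M, ∃ X : Finset unitInterval,
      (1 - √(Real.exp (n * δ ^ 2) / m)) / 2 ≤
      P.real {ω | ∃ x ∈ X, δ * (2 : ℝ) ^ ((j : ℝ) / 2) * |W.ψ y| / 2 ≤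
        |T (whiteNoise B n f ω) x - f x|} := by
  classical
  obtain ⟨f, hfα, hfβ⟩ := hW.exists_base hs hM
  have hK : 1 ≤ W.K := by
    have := hW.wavelet_support hy
    by_contra h
    have h0 : W.K = 0 := by omega
    rw [h0] at this
    norm_num at this
    linarith
  have hp : (0 : ℝ) < (2 : ℝ) ^ j := by positivity
  -- The spacing exceeds the support length of a translate, so the supports are disjoint. Starting
  -- at `i + 1` avoids index `0`, and both ends stay clear of the boundary functions.
  let κ : Fin m → ℕ := fun i ↦ 2 * (W.K + W.N) * (i + 1)
  have hκ : ∀ i, κ i + 2 * (W.K + W.N) ≤ 2 ^ j ∧ 2 * (W.K + W.N) ≤ κ i := fun i ↦ by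
    have h1 : 2 * (W.K + W.N) * (i + 2) ≤ 2 * (W.K + W.N) * (m + 1) :=
      Nat.mul_le_mul_left _ (by omega)
    constructor
    · calc κ i + 2 * (W.K + W.N) = 2 * (W.K + W.N) * (i + 2) := by simp only [κ]; ring
        _ ≤ _ := h1.trans hmj
    · exact Nat.le_mul_of_pos_right _ (by omega)
  have hκlt : ∀ i, κ i < 2 ^ j := fun i ↦ by have := hκ i; omega
  have hcast : ((2 ^ j : ℕ) : ℝ) = (2 : ℝ) ^ j := by push_cast; rfl
  have hκj : ∀ i, (κ i : ℝ) + W.K ≤ (2 : ℝ) ^ j := fun i ↦ by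
    rw [← hcast]; have := hκ i; exact_mod_cast (by omega : κ i + W.K ≤ 2 ^ j)
  have hκK : ∀ i, (W.K : ℝ) ≤ κ i := fun i ↦ by
    have := hκ i; exact_mod_cast (by omega : W.K ≤ κ i)
  let h : Fin m → C(unitInterval, ℝ) := fun i ↦ δ • hW.waveletMap j ⟨κ i, hκlt i⟩
  have happly : ∀ i x, h i x = δ * ((2 : ℝ) ^ ((j : ℝ) / 2) * W.ψ ((2 : ℝ) ^ j * x - κ i)) :=
    fun i x ↦ by
      rw [← waveletFn_of_interior (by have := hκ i; omega) (by have := hκ i; omega)]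
      rfl
  let u : Fin m → unitInterval := fun i ↦ dyadic j (κ i - W.K) (by have := hκ i; omega)
  let w : Fin m → unitInterval := fun i ↦ dyadic j (κ i + W.K) (by have := hκ i; omega)
  have hy' := hW.wavelet_support hy
  let x : Fin m → unitInterval := fun i ↦ ⟨(κ i + y) / 2 ^ j,
    div_nonneg (by linarith [hκK i]) hp.le,
    div_le_one_of_le₀ (by linarith [hκj i]) hp.le⟩
  have : Nonempty (Fin m) := ⟨⟨0, hm⟩⟩
  have hmain := exists_estimator_error hB hn f h u w (fun i z hz ↦ ?_)
    (fun i l hil ↦ ?_) (S := n * δ ^ 2) (fun i ↦ ?_)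
    (r := δ * (2 : ℝ) ^ ((j : ℝ) / 2) * |W.ψ y| / 2) x (fun i ↦ ?_) hT
  · obtain ⟨g, hg, hgP⟩ := hmain
    refine ⟨g, ?_, Finset.univ.image x, ?_⟩
    · rcases hg with rfl | ⟨i, rfl⟩
      · have hj0 : 2 * (W.K + W.N) < 2 ^ j := by have := hκ ⟨0, hm⟩; omega
        -- The unperturbed function is the case `δ = 0`.
        have := hW.base_add_mem (smax := smax) (ε := ε) hε1 hρ hM hfα hfβ hj
          (k := ⟨κ ⟨0, hm⟩, hκlt _⟩) (by have := hκ ⟨0, hm⟩; simp only; omega) (δ := 0)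
          (by simpa using hM)
        simpa using this
      · exact hW.base_add_mem hε1 hρ hM hfα hfβ hj
          (by have := hκ i; simp only; omega) (by rwa [abs_of_nonneg hδ0])
    · simpa using hgP
  · rw [happly]
    by_contra hne
    have hne' : W.ψ ((2 : ℝ) ^ j * z - κ i) ≠ 0 := fun h0 ↦ hne (by rw [h0]; ring)
    have h2 := hW.wavelet_support hne'
    have hcs : ((κ i - W.K : ℕ) : ℝ) = κ i - W.K := by
      rw [Nat.cast_sub (by have := hκ i; omega)]
    rcases hz with hz | hz
    · have hz' : (z : ℝ) < ((κ i - W.K : ℕ) : ℝ) / 2 ^ j := hz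
      rw [lt_div_iff₀ hp, hcs] at hz'
      linarith
    · have hz' : ((κ i + W.K : ℕ) : ℝ) / 2 ^ j < z := hz
      rw [div_lt_iff₀ hp] at hz'
      push_cast at hz'
      linarith
  · have key : ∀ a b : Fin m, a < b → w a ≤ u b := fun a b hab ↦ by
      have h1 : κ a + 2 * (W.K + W.N) ≤ κ b := by
        calc κ a + 2 * (W.K + W.N) = 2 * (W.K + W.N) * (a + 2) := by simp only [κ]; ring
          _ ≤ κ b := Nat.mul_le_mul_left _ (by have : (a : ℕ) < b := hab; omega)
      change ((κ a + W.K : ℕ) : ℝ) / 2 ^ j ≤ ((κ b - W.K : ℕ) : ℝ) / 2 ^ j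
      have h2 : κ a + W.K ≤ κ b - W.K := by omega
      gcongr
    rcases lt_or_gt_of_ne hil with h1 | h1
    · exact Or.inl (key i l h1)
    · exact Or.inr (key l i h1)
  · have : ∀ z, h i z ^ 2 = δ ^ 2 * hW.waveletMap j ⟨κ i, hκlt i⟩ z ^ 2 := fun z ↦ by
      rw [← mul_pow]; rfl
    simp only [this]
    rw [integral_const_mul, hW.integral_sq_waveletMap hj, mul_one]
  · rw [happly]
    have : (2 : ℝ) ^ j * (x i : ℝ) - κ i = y := by
      simp only [x]; field_simp; ring
    rw [this, abs_mul, abs_mul, abs_of_nonneg hδ0,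
      abs_of_pos (show (0 : ℝ) < (2 : ℝ) ^ ((j : ℝ) / 2) by positivity)]
    linarith

end IntervalWavelets

/-! ### Lower bound at the optimal rate -/

/-- Half of the exponent absorbs both `log^β` and the constant `κ`, by `log^β n = o(n^{β/2})`. -/
lemma eventually_rpow_le_div_log {β : ℝ} (hβ : 0 < β) {κ : ℝ} (hκ : 0 < κ) :
    ∀ᶠ n : ℕ in atTop, (n : ℝ) ^ (β / 2) ≤ κ * ((n : ℝ) / Real.log n) ^ β := by
  have h := (isLittleO_log_rpow_rpow_atTop β (half_pos hβ)).bound hκ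
  filter_upwards [tendsto_natCast_atTop_atTop.eventually h, eventually_ge_atTop 3] with n hn hn3
  have hn0 : (0 : ℝ) < n := by positivity
  have hl : 0 < Real.log n := Real.log_pos (by exact_mod_cast (by omega : 1 < n))
  rw [Real.norm_of_nonneg (by positivity), Real.norm_of_nonneg (by positivity)] at hn
  rw [Real.div_rpow hn0.le hl.le, ← mul_div_assoc, le_div_iff₀ (by positivity)]
  calc (n : ℝ) ^ (β / 2) * Real.log n ^ β ≤ (n : ℝ) ^ (β / 2) * (κ * (n : ℝ) ^ (β / 2)) := by
        gcongr
    _ = κ * (n : ℝ) ^ β := by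
        rw [mul_left_comm, ← Real.rpow_add hn0, add_halves]

lemma tendsto_div_log_rpow {β : ℝ} (hβ : 0 < β) :
    Tendsto (fun n : ℕ ↦ ((n : ℝ) / Real.log n) ^ β) atTop atTop := by
  refine tendsto_atTop_mono' _ ?_
    ((tendsto_rpow_atTop (half_pos hβ)).comp tendsto_natCast_atTop_atTop)
  filter_upwards [eventually_rpow_le_div_log hβ one_pos] with n hn
  simpa using hn

namespace IntervalWavelets.IsWaveletBasis

variable {W : IntervalWavelets}

/-- Over the self-similar class no estimator has an error smaller than the optimal rate, with
probability larger than `1/2`. -/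
theorem exists_lower_bound (hW : W.IsWaveletBasis) {Ω : Type*} [MeasurableSpace Ω]
    {P : Measure Ω} {B : ℝ≥0 → Ω → ℝ} [IsProbabilityMeasure P] (hB : IsPreBrownianReal B P)
    {smax ε s M : ℝ} {ρ : ℕ} (hε1 : ε < 1) (hρ : 1 ≤ ρ) (hs : 0 < s) (hM : 0 < M) {γ : ℝ}
    (hγ : γ < 1 / 2) :
    ∃ c > 0, ∀ᶠ n : ℕ in atTop, ∀ T, IsEstimator T →
      ∃ f ∈ W.selfSimilarClass smax ε ρ s M, ∃ X : Finset unitInterval,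
      γ ≤ P.real {ω | ∃ x ∈ X, c * optimalRate s n ≤ |T (whiteNoise B n f ω) x - f x|} := by
  obtain ⟨y, hy⟩ := hW.exists_wavelet_ne_zero
  have hy' : 0 < |W.ψ y| := abs_pos.2 hy
  set β : ℝ := 1 / (2 * s + 1) with hβ
  have hβ0 : 0 < β := by positivity
  -- `η ≤ M²` keeps the perturbed functions in `C^s(M)`; `η ≤ β / 2` keeps `n^η` below a small
  -- multiple of the number of alternatives.
  set η : ℝ := min (M ^ 2) (β / 2) with hη
  have hη0 : 0 < η := lt_min (by positivity) (by positivity)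
  set D : ℕ := W.K + W.N with hD
  have hD0 : 0 < D := by
    by_contra h
    have := hW.wavelet_support hy
    have hK : W.K = 0 := by omega
    rw [hK] at this
    norm_num at this
    linarith
  have hDr : (0 : ℝ) < D := by exact_mod_cast hD0
  -- The value with `(1 - τ) / 2 = γ`.
  set τ : ℝ := 1 - 2 * γ with hτ
  have hτ0 : 0 < τ := by linarith
  have hκ : 0 < τ ^ 2 / (8 * D) := by positivity
  refine ⟨√η * |W.ψ y| / 4, by positivity, ?_⟩
  -- `R ≥ 2^(j₀+1)` forces `j ≥ j₀`; `R ≥ 16 D` absorbs the losses from rounding and from `m = q -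
  -- 1`, leaving `m ≥ R / (8 D)`.
  filter_upwards [eventually_rpow_le_div_log hβ0 hκ, eventually_ge_atTop 3,
    (tendsto_div_log_rpow hβ0).eventually_ge_atTop (2 ^ (W.j₀ + 1)),
    (tendsto_div_log_rpow hβ0).eventually_ge_atTop (16 * D)] with n hn1 hn3 hnj hnD T hT
  have hn0 : (0 : ℝ) < n := by positivity
  have hn1' : (1 : ℝ) ≤ n := by exact_mod_cast (by omega : 1 ≤ n)
  have hl : 0 < Real.log n := Real.log_pos (by exact_mod_cast (by omega : 1 < n))
  set Q : ℝ := (n : ℝ) / Real.log n with hQ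
  have hQ0 : 0 < Q := by positivity
  set R : ℝ := Q ^ β with hR
  have hR0 : 0 < R := by positivity
  have hR1 : 1 ≤ R := (one_le_pow₀ (by norm_num)).trans hnj
  obtain ⟨j, hj1, hj2⟩ := exists_nat_pow_near hR1 (one_lt_two (α := ℝ))
  have hj : W.j₀ ≤ j := by
    have := (pow_lt_pow_iff_right₀ (one_lt_two (α := ℝ))).1 (hnj.trans_lt hj2)
    omega
  have hpj : (2 : ℝ) ^ (j : ℝ) = 2 ^ j := Real.rpow_natCast _ _
  have hjR : R / 2 ≤ 2 ^ j := by rw [pow_succ] at hj2; linarith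
  set q : ℕ := 2 ^ j / (2 * D) with hq
  have hq1 : 2 * D * q ≤ 2 ^ j := Nat.mul_div_le _ _
  have hq2 : (2 : ℝ) ^ j < 2 * D * (q + 1) := by
    have := Nat.lt_mul_div_succ (2 ^ j) (show 0 < 2 * D by omega)
    exact_mod_cast this
  have hqR : R / (8 * D) + 1 ≤ q := by
    have h1 : R / 2 < 2 * D * (q + 1) := hjR.trans_lt hq2
    have h2 : R / (8 * D) * (8 * D) = R := by field_simp
    have h3 : 2 ≤ R / (8 * D) := by rw [le_div_iff₀ (by positivity)]; linarith
    have h4 : 2 * (R / (8 * D)) < q + 1 := by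
      have : (2 * D) * (2 * (R / (8 * D))) < 2 * D * (q + 1) := by
        calc (2 * D) * (2 * (R / (8 * D))) = R / 2 := by field_simp; ring
          _ < _ := h1
      exact lt_of_mul_lt_mul_left this (by positivity)
    linarith
  have hq0 : 1 < q := by
    have : (1 : ℝ) < q := lt_of_lt_of_le (by linarith [show 0 < R / (8 * D) by positivity]) hqR
    exact_mod_cast this
  obtain ⟨m, hm⟩ : ∃ m, q = m + 1 := ⟨q - 1, by omega⟩
  have hm0 : 0 < m := by omega
  have hmR : R / (8 * D) ≤ m := by rw [hm] at hqR; push_cast at hqR; linarith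
  set δ : ℝ := √η * Q ^ (-(1 / 2) : ℝ) with hδ
  have hδ0 : 0 ≤ δ := by positivity
  have hδ2 : n * δ ^ 2 = η * Real.log n := by
    rw [hδ, mul_pow, Real.sq_sqrt hη0.le, ← Real.rpow_natCast, ← Real.rpow_mul hQ0.le]
    norm_num
    rw [Real.rpow_neg_one, hQ]
    field_simp
  have hδM : (2 : ℝ) ^ ((j : ℝ) * (s + 1 / 2)) * δ ≤ M := by
    have h1 : (2 : ℝ) ^ ((j : ℝ) * (s + 1 / 2)) ≤ Q ^ (1 / 2 : ℝ) := by
      rw [Real.rpow_mul (by norm_num), hpj]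
      calc ((2 : ℝ) ^ j) ^ (s + 1 / 2) ≤ R ^ (s + 1 / 2) := by gcongr
        _ = Q ^ (1 / 2 : ℝ) := by
          rw [hR, ← Real.rpow_mul hQ0.le]
          congr 1
          rw [hβ]; field_simp
    calc _ ≤ Q ^ (1 / 2 : ℝ) * δ := by gcongr
      _ = √η := by
        rw [hδ, mul_left_comm, ← Real.rpow_add hQ0]; norm_num
      _ ≤ √(M ^ 2) := Real.sqrt_le_sqrt (min_le_left _ _)
      _ = M := Real.sqrt_sq hM.le
  obtain ⟨f, hf, X, hX⟩ := hW.exists_error hB (smax := smax) (ε := ε) (s := s) (M := M) (ρ := ρ)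
    hε1 hρ hs hM.le hy (n := n) (by omega) hj hm0 (by rw [← hm]; exact hq1) hδ0 hδM hT
  refine ⟨f, hf, X, ?_⟩
  have hτle : √(Real.exp (n * δ ^ 2) / m) ≤ τ := by
    refine Real.sqrt_le_iff.2 ⟨hτ0.le, ?_⟩
    have hm0' : (0 : ℝ) < m := by exact_mod_cast hm0
    rw [div_le_iff₀ hm0', hδ2]
    calc Real.exp (η * Real.log n) = (n : ℝ) ^ η := by
          rw [Real.rpow_def_of_pos hn0, mul_comm]
      _ ≤ (n : ℝ) ^ (β / 2) := Real.rpow_le_rpow_of_exponent_le hn1' (min_le_right _ _)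
      _ ≤ τ ^ 2 / (8 * D) * R := hn1
      _ = τ ^ 2 * (R / (8 * D)) := by ring
      _ ≤ τ ^ 2 * m := by gcongr
  have hrate : √η * |W.ψ y| / 4 * optimalRate s n ≤
      δ * (2 : ℝ) ^ ((j : ℝ) / 2) * |W.ψ y| / 2 := by
    have h1 : R ^ (1 / 2 : ℝ) ≤ 2 * (2 : ℝ) ^ ((j : ℝ) / 2) := by
      -- `R < 2 * 2 ^ j`; the cruder factor `4` has an exact root.
      calc R ^ (1 / 2 : ℝ) ≤ (4 * 2 ^ j : ℝ) ^ (1 / 2 : ℝ) := by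
            gcongr
            have : (0 : ℝ) < 2 ^ j := by positivity
            linarith
        _ = 2 * (2 : ℝ) ^ ((j : ℝ) / 2) := by
            rw [Real.mul_rpow (by norm_num) (by positivity), ← hpj,
              ← Real.rpow_mul (by norm_num), ← Real.sqrt_eq_rpow]
            congr 1
            · rw [show (4 : ℝ) = 2 ^ 2 by norm_num]; exact Real.sqrt_sq (by norm_num)
            · congr 1; ring
    have h2 : optimalRate s n = Q ^ (-(1 / 2) : ℝ) * R ^ (1 / 2 : ℝ) := by
      rw [hR, ← Real.rpow_mul hQ0.le, ← Real.rpow_add hQ0, optimalRate]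
      congr 1
      rw [hβ]; field_simp; ring
    rw [h2, hδ]
    have h3 : 0 ≤ √η * |W.ψ y| / 4 * Q ^ (-(1 / 2) : ℝ) := by positivity
    nlinarith [mul_le_mul_of_nonneg_left h1 h3]
  calc γ = (1 - τ) / 2 := by rw [hτ]; ring
    _ ≤ _ := by gcongr
    _ ≤ _ := hX
    _ ≤ _ := measureReal_mono fun ω hω ↦ by
      obtain ⟨x, hx, hle⟩ := hω
      exact ⟨x, hx, hrate.trans hle⟩

end IntervalWavelets.IsWaveletBasis

lemma setOf_exists_le_subset {Ω : Type*} {B : ℝ≥0 → Ω → ℝ}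
    {T : (unitInterval → ℝ) → unitInterval → ℝ} {n : ℕ}
    {f : C(unitInterval, ℝ)} {X : Finset unitInterval} {r : ℝ} :
    {ω | ∃ x ∈ X, r ≤ |T (whiteNoise B n f ω) x - f x|} ⊆
      {ω | ENNReal.ofReal r ≤ supDist (T (whiteNoise B n f ω)) f} := by
  rintro ω ⟨x, -, hx⟩
  exact (ENNReal.ofReal_le_ofReal hx).trans
    (le_iSup (fun x ↦ ENNReal.ofReal |T (whiteNoise B n f ω) x - f x|) x)

/-! ### Excess probability and risk over the self-similar class -/

section Consequences

variable {Ω : Type*} [MeasurableSpace Ω] {P : Measure Ω} {B : ℝ≥0 → Ω → ℝ}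

/-- Markov's inequality. The supremum over `[0,1]` need not be measurable, but the event on the
finite set `X` is null measurable, and it forces a large supremum. -/
lemma mul_le_lintegral_supDist [IsProbabilityMeasure P] (hB : IsPreBrownianReal B P)
    {T : (unitInterval → ℝ) → unitInterval → ℝ} (hT : IsEstimator T) (n : ℕ)
    (f : C(unitInterval, ℝ)) (X : Finset unitInterval) (r : ℝ) :
    ENNReal.ofReal r * P {ω | ∃ x ∈ X, r ≤ |T (whiteNoise B n f ω) x - f x|} ≤
      ∫⁻ ω, supDist (T (whiteNoise B n f ω)) f ∂P := by
  set E := {ω | ∃ x ∈ X, r ≤ |T (whiteNoise B n f ω) x - f x|} with hE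
  have hA : MeasurableSet {y : unitInterval → ℝ | ∃ x ∈ X, r ≤ |T y x - f x|} := by
    have : {y : unitInterval → ℝ | ∃ x ∈ X, r ≤ |T y x - f x|} =
        ⋃ x ∈ X, {y | r ≤ |T y x - f x|} := by ext y; simp
    rw [this]
    exact X.measurableSet_biUnion fun x _ ↦
      measurableSet_le measurable_const ((hT x).sub_const _).abs
  have hEm : NullMeasurableSet E P := nullMeasurable_whiteNoise hB n f hA
  rw [← lintegral_indicator_const₀ hEm]
  refine lintegral_mono fun ω ↦ ?_
  by_cases hω : ω ∈ E
  · rw [Set.indicator_of_mem hω]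
    exact setOf_exists_le_subset hω
  · rw [Set.indicator_of_notMem hω]; exact zero_le

lemma minimaxRisk_mono {F G : Set C(unitInterval, ℝ)} (h : F ⊆ G) (n : ℕ) :
    minimaxRisk P B F n ≤ minimaxRisk P B G n :=
  iInf₂_mono fun _ _ ↦ biSup_mono fun _ hf ↦ h hf

end Consequences

namespace IntervalWavelets.IsWaveletBasis

variable {W : IntervalWavelets}

theorem not_limsup_le (hW : W.IsWaveletBasis) {Ω : Type*} [MeasurableSpace Ω]
    {P : Measure Ω} {B : ℝ≥0 → Ω → ℝ} [IsProbabilityMeasure P] (hB : IsPreBrownianReal B P)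
    {smax ε s M : ℝ} {ρ : ℕ} (hε1 : ε < 1) (hρ : 1 ≤ ρ) (hs : 0 < s) (hM : 0 < M) {γ : ℝ}
    (hγ0 : 0 < γ) (hγ : γ < 1 / 2) {T : ℕ → (unitInterval → ℝ) → unitInterval → ℝ}
    (hT : ∀ n, IsEstimator (T n)) {r : ℕ → ℝ} (hr : r =o[atTop] optimalRate s) :
    ¬ (limsup (fun n : ℕ ↦ ⨆ f ∈ W.selfSimilarClass smax ε ρ s M,
        P {ω | ENNReal.ofReal (r n) ≤ supDist (T n (whiteNoise B n f ω)) f}) atTop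
      ≤ ENNReal.ofReal γ) := by
  -- The room between `γ` and `1/2` makes the limsup strictly larger than `γ`.
  obtain ⟨γ', h1, h2⟩ := exists_between hγ
  obtain ⟨c, hc, h⟩ := hW.exists_lower_bound hB (smax := smax) (ε := ε) (s := s) (M := M)
    (ρ := ρ) hε1 hρ hs hM h2
  refine not_le.2 (lt_of_lt_of_le
    ((ENNReal.ofReal_lt_ofReal_iff (hγ0.trans h1)).2 h1) (le_limsup_of_frequently_le
    (Eventually.frequently ?_)))
  filter_upwards [h, hr.bound hc, eventually_ge_atTop 3] with n hn hrn hn3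
  have hrate : 0 ≤ optimalRate s n := by
    have : 0 ≤ Real.log n := Real.log_natCast_nonneg n
    unfold optimalRate; positivity
  rw [Real.norm_of_nonneg hrate] at hrn
  obtain ⟨f, hf, X, hX⟩ := hn (T n) (hT n)
  refine le_trans ?_ (le_iSup₂ (f := fun (f : C(unitInterval, ℝ)) (_ : f ∈
    W.selfSimilarClass smax ε ρ s M) ↦
    P {ω | ENNReal.ofReal (r n) ≤ supDist (T n (whiteNoise B n f ω)) f}) f hf)
  refine (ENNReal.ofReal_le_of_le_toReal hX).trans (measure_mono ?_)
  refine fun ω hω ↦ ?_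
  refine le_trans (ENNReal.ofReal_le_ofReal ((le_abs_self _).trans hrn)) ?_
  exact setOf_exists_le_subset hω

theorem exists_le_minimaxRisk (hW : W.IsWaveletBasis) {Ω : Type*} [MeasurableSpace Ω]
    {P : Measure Ω} {B : ℝ≥0 → Ω → ℝ} [IsProbabilityMeasure P] (hB : IsPreBrownianReal B P)
    {smax ε s M : ℝ} {ρ : ℕ} (hε1 : ε < 1) (hρ : 1 ≤ ρ) (hs : 0 < s) (hM : 0 < M) :
    ∃ c > 0, ∀ᶠ n : ℕ in atTop, ENNReal.ofReal (c * optimalRate s n) ≤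
      minimaxRisk P B (W.selfSimilarClass smax ε ρ s M) n := by
  obtain ⟨c, hc, h⟩ := hW.exists_lower_bound hB (smax := smax) (ε := ε) (s := s) (M := M)
    (ρ := ρ) hε1 hρ hs hM (γ := 1 / 4) (by norm_num)
  refine ⟨c / 4, by positivity, ?_⟩
  filter_upwards [h] with n hn
  refine le_iInf₂ fun T hT ↦ ?_
  obtain ⟨f, hf, X, hX⟩ := hn T hT
  refine le_trans ?_ (le_iSup₂ (f := fun (f : C(unitInterval, ℝ)) (_ : f ∈
    W.selfSimilarClass smax ε ρ s M) ↦ ∫⁻ ω, supDist (T (whiteNoise B n f ω)) f ∂P) f hf)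
  refine le_trans ?_ (mul_le_lintegral_supDist hB hT n f X (c * optimalRate s n))
  calc ENNReal.ofReal (c / 4 * optimalRate s n)
      = ENNReal.ofReal (c * optimalRate s n) * ENNReal.ofReal (1 / 4) := by
        rw [← ENNReal.ofReal_mul' (by norm_num)]; congr 1; ring
    _ ≤ _ := by gcongr; exact ENNReal.ofReal_le_of_le_toReal hX

end IntervalWavelets.IsWaveletBasis

/-! ### Empirical coefficients on a fine grid -/

/-- The point `i / m` of the regular grid with `m` cells, truncated to `[0,1]`. -/
def gridPoint (m i : ℕ) : unitInterval := Set.projIcc 0 1 zero_le_one ((i : ℝ) / m)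

lemma monotone_gridPoint (m : ℕ) : Monotone (gridPoint m) := fun i j hij ↦
  Set.monotone_projIcc _ (by gcongr)

lemma gridPoint_zero (m : ℕ) : gridPoint m 0 = 0 := by
  simp [gridPoint]

lemma gridPoint_self {m : ℕ} (hm : m ≠ 0) : gridPoint m m = 1 := by
  have : (m : ℝ) ≠ 0 := by exact_mod_cast hm
  simp [gridPoint, div_self this]

lemma dist_gridPoint_le (m i : ℕ) {x : unitInterval}
    (hx : x ∈ Set.Ioc (gridPoint m i) (gridPoint m (i + 1))) : dist x (gridPoint m i) ≤ 1 / m := by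
  have h1 : (gridPoint m i : ℝ) ≤ x := hx.1.le
  have h2 : (x : ℝ) ≤ gridPoint m (i + 1) := hx.2
  have h3 : (gridPoint m (i + 1) : ℝ) - gridPoint m i ≤ 1 / m := by
    simp only [gridPoint, Set.coe_projIcc]
    have : ((i + 1 : ℕ) : ℝ) / m = i / m + 1 / m := by push_cast; ring
    rw [this]
    have h4 : (0 : ℝ) ≤ 1 / m := by positivity
    rw [max_def, max_def, min_def, min_def]
    split_ifs <;> linarith
  rw [Subtype.dist_eq, Real.dist_eq, abs_of_nonneg (by linarith)]
  linarith

/-- Finitely many continuous functions are nearly constant on the cells of a fine grid. -/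
lemma exists_grid {ι : Type*} [Fintype ι] (b : ι → C(unitInterval, ℝ)) {τ : ℝ} (hτ : 0 < τ) :
    ∃ m ≠ 0, ∀ a i, ∀ x ∈ Set.Ioc (gridPoint m i) (gridPoint m (i + 1)),
      |b a x - b a (gridPoint m i)| ≤ τ := by
  -- Uniform continuity of the vector-valued map gives one mesh for the whole family.
  have hc : Continuous fun x a ↦ b a x := continuous_pi fun a ↦ (b a).continuous
  obtain ⟨d, hd, h⟩ := Metric.uniformContinuous_iff.1
    (CompactSpace.uniformContinuous_of_continuous hc) τ hτ
  obtain ⟨m, hm⟩ := exists_nat_one_div_lt hd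
  refine ⟨m + 1, by omega, fun a i x hx ↦ ?_⟩
  have h1 := h ((dist_gridPoint_le _ _ hx).trans_lt (by push_cast; exact hm))
  rw [← Real.dist_eq]
  exact (dist_le_pi_dist (fun a ↦ b a x) (fun a ↦ b a (gridPoint (m + 1) i)) a).trans h1.le

/-- The Riemann–Stieltjes sum approximating `∫ b dy`. -/
def riemannSum (m : ℕ) (b y : unitInterval → ℝ) : ℝ :=
  ∑ i ∈ Finset.range m, b (gridPoint m i) * (y (gridPoint m (i + 1)) - y (gridPoint m i))

lemma measurable_riemannSum (m : ℕ) (b : unitInterval → ℝ) : Measurable (riemannSum m b) := by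
  unfold riemannSum
  fun_prop

section WhiteNoise

/-- The noise term does not depend on `f`, so one bound for it serves the whole class. -/
lemma riemannSum_whiteNoise {Ω : Type*} {B : ℝ≥0 → Ω → ℝ} (m : ℕ) (b : unitInterval → ℝ) (n : ℕ)
    (f : C(unitInterval, ℝ)) (ω : Ω) :
    riemannSum m b (whiteNoise B n f ω) =
      ∑ i ∈ Finset.range m,
        b (gridPoint m i) * (∫ u in Set.Ioc (gridPoint m i) (gridPoint m (i + 1)), f u) +
      riemannSum m b (whiteNoise B n 0 ω) := by
  rw [riemannSum, riemannSum, ← Finset.sum_add_distrib]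
  refine Finset.sum_congr rfl fun i _ ↦ ?_
  have h := monotone_gridPoint m i.le_succ
  rw [whiteNoise_increment n f ω h, whiteNoise_increment n 0 ω h]
  simp
  ring

lemma setIntegral_Ioc_zero_one (g : unitInterval → ℝ) :
    ∫ u in Set.Ioc (0 : unitInterval) 1, g u = ∫ u, g u := by
  rw [← integral_Icc_eq_integral_Ioc]
  have : Set.Icc (0 : unitInterval) 1 = Set.univ :=
    Set.eq_univ_of_forall fun x ↦ ⟨unitInterval.nonneg', unitInterval.le_one'⟩
  rw [this, Measure.restrict_univ]

lemma sum_setIntegral_gridPoint {m : ℕ} (hm : m ≠ 0) {g : unitInterval → ℝ}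
    (hg : Integrable g) :
    ∑ i ∈ Finset.range m, ∫ u in Set.Ioc (gridPoint m i) (gridPoint m (i + 1)), g u =
      ∫ u, g u := by
  rw [sum_setIntegral_Ioc (monotone_gridPoint m) hg, gridPoint_zero, gridPoint_self hm,
    setIntegral_Ioc_zero_one]

lemma abs_sum_mul_setIntegral_sub_le {m : ℕ} (hm : m ≠ 0) (b f : C(unitInterval, ℝ)) {τ D : ℝ}
    (hτ : 0 ≤ τ) (hb : ∀ i, ∀ x ∈ Set.Ioc (gridPoint m i) (gridPoint m (i + 1)),
      |b x - b (gridPoint m i)| ≤ τ) (hf : ∀ x, |f x| ≤ D) :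
    |∑ i ∈ Finset.range m,
        b (gridPoint m i) * (∫ u in Set.Ioc (gridPoint m i) (gridPoint m (i + 1)), f u) -
      ∫ u, f u * b u| ≤ τ * D := by
  have hD : 0 ≤ D := (abs_nonneg _).trans (hf 0)
  have hfi := integrable_unitInterval f.continuous
  have hfb : Integrable (fun u ↦ f u * b u) (volume : Measure unitInterval) :=
    integrable_unitInterval (f.continuous.mul b.continuous)
  rw [← sum_setIntegral_gridPoint hm hfb, ← Finset.sum_sub_distrib]
  calc _ ≤ ∑ i ∈ Finset.range m, |b (gridPoint m i) *
        (∫ u in Set.Ioc (gridPoint m i) (gridPoint m (i + 1)), f u) -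
        ∫ u in Set.Ioc (gridPoint m i) (gridPoint m (i + 1)), f u * b u| :=
        Finset.abs_sum_le_sum_abs _ _
    _ ≤ ∑ i ∈ Finset.range m,
        ∫ _u in Set.Ioc (gridPoint m i) (gridPoint m (i + 1)), τ * D := by
        refine Finset.sum_le_sum fun i _ ↦ ?_
        rw [← integral_const_mul, ← integral_sub (hfi.const_mul _).integrableOn
          hfb.integrableOn]
        refine (abs_integral_le_integral_abs).trans (setIntegral_mono_on
          ((hfi.const_mul _).sub hfb).abs.integrableOn (integrable_const _).integrableOn
          measurableSet_Ioc fun x hx ↦ ?_)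
        have : b (gridPoint m i) * f x - f x * b x = -(b x - b (gridPoint m i)) * f x := by ring
        rw [this, abs_mul, abs_neg]
        exact mul_le_mul (hb i x hx) (hf x) (abs_nonneg _) hτ
    _ = τ * D := by
        rw [sum_setIntegral_gridPoint hm (integrable_const _)]; simp

variable {Ω : Type*} [MeasurableSpace Ω] {P : Measure Ω} {B : ℝ≥0 → Ω → ℝ}

lemma mgf_riemannSum (hB : IsPreBrownianReal B P) (n m : ℕ) (b : unitInterval → ℝ) (t : ℝ) :
    mgf (fun ω ↦ riemannSum m b (whiteNoise B n 0 ω)) P t =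
      Real.exp (t ^ 2 / (2 * n) * ∑ i ∈ Finset.range m,
        ∫ _u in Set.Ioc (gridPoint m i) (gridPoint m (i + 1)), b (gridPoint m i) ^ 2) := by
  have hmono := monotone_gridPoint m
  have hind := (iIndepFun_whiteNoise_increment hB n 0 hmono).comp
    (fun i x ↦ b (gridPoint m i) * x) (fun i ↦ by fun_prop)
  have hlaw : ∀ i, HasLaw (fun ω ↦ b (gridPoint m i) * (whiteNoise B n 0 ω (gridPoint m (i + 1)) -
      whiteNoise B n 0 ω (gridPoint m i))) _ P := fun i ↦
    gaussianReal_const_mul (hasLaw_whiteNoise_increment hB n 0 (hmono i.le_succ)) _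
  have h := hind.mgf_sum₀ (t := t) (fun i ↦ (hlaw i).aemeasurable) (Finset.range m)
  have hfun : (fun ω ↦ riemannSum m b (whiteNoise B n 0 ω)) = ∑ i ∈ Finset.range m,
      (fun x ↦ b (gridPoint m i) * x) ∘ (fun ω ↦ whiteNoise B n 0 ω (gridPoint m (i + 1)) -
      whiteNoise B n 0 ω (gridPoint m i)) := by
    ext ω
    simp [riemannSum]
  rw [hfun, h, Finset.mul_sum, Real.exp_sum]
  refine Finset.prod_congr rfl fun i _ ↦ ?_
  have h1 := mgf_gaussianReal (hlaw i).map_eq t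
  refine h1.trans ?_
  have hl : (0 : ℝ) ≤ gridPoint m (i + 1) - gridPoint m i := sub_nonneg.2 (hmono i.le_succ)
  congr 1
  simp only [NNReal.coe_mul, NNReal.coe_mk, coe_incrementVar (hmono i.le_succ),
    setIntegral_const, Measure.real, unitInterval.volume_Ioc, ENNReal.toReal_ofReal hl]
  simp
  ring

/-- The noise sum is Gaussian with variance `1/n` times the squared norm of a step function within
`1` of `b`. That norm is at most `∫ (2 b² + 2) = 4`. -/
lemma mgf_riemannSum_le (hB : IsPreBrownianReal B P) (n : ℕ) {m : ℕ} (hm : m ≠ 0)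
    {b : C(unitInterval, ℝ)} {τ : ℝ} (hτ : τ ≤ 1)
    (hb : ∀ i, ∀ x ∈ Set.Ioc (gridPoint m i) (gridPoint m (i + 1)),
      |b x - b (gridPoint m i)| ≤ τ) (hb1 : ∫ x, b x ^ 2 = 1) (t : ℝ) :
    mgf (fun ω ↦ riemannSum m b (whiteNoise B n 0 ω)) P t ≤ Real.exp (2 * t ^ 2 / n) := by
  have hbi := integrable_unitInterval (b.continuous.pow 2)
  have hg : Integrable (fun u ↦ 2 * b u ^ 2 + 2) (volume : Measure unitInterval) :=
    (hbi.const_mul 2).add (integrable_const _)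
  have hsum : ∑ i ∈ Finset.range m,
      ∫ _u in Set.Ioc (gridPoint m i) (gridPoint m (i + 1)), b (gridPoint m i) ^ 2 ≤ 4 := by
    calc _ ≤ ∑ i ∈ Finset.range m,
        ∫ u in Set.Ioc (gridPoint m i) (gridPoint m (i + 1)), (2 * b u ^ 2 + 2) := by
          refine Finset.sum_le_sum fun i _ ↦ setIntegral_mono_on
            (integrable_const _).integrableOn hg.integrableOn measurableSet_Ioc fun x hx ↦ ?_
          have h1 := abs_le.1 ((hb i x hx).trans hτ)
          nlinarith [sq_nonneg (b x + (b x - b (gridPoint m i)))]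
      _ = ∫ u, (2 * b u ^ 2 + 2) := sum_setIntegral_gridPoint hm hg
      _ = 4 := by
        have h2 : Integrable (fun u ↦ 2 * b u ^ 2) (volume : Measure unitInterval) :=
          hbi.const_mul 2
        rw [integral_add h2 (integrable_const _), integral_const_mul, hb1]
        norm_num
  rw [mgf_riemannSum hB]
  refine Real.exp_le_exp.2 ?_
  calc _ ≤ t ^ 2 / (2 * n) * 4 := by gcongr
    _ = 2 * t ^ 2 / n := by
      rcases eq_or_ne (n : ℝ) 0 with h | h
      · simp [h]
      · field_simp; ring

lemma integrable_exp_riemannSum [IsProbabilityMeasure P] (hB : IsPreBrownianReal B P) (n m : ℕ)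
    (b : unitInterval → ℝ) (t : ℝ) :
    Integrable (fun ω ↦ Real.exp (t * riemannSum m b (whiteNoise B n 0 ω))) P := by
  rw [← mgf_pos_iff, mgf_riemannSum hB]
  exact Real.exp_pos _

/-! ### Risk of the projection estimator -/

/-- The projection estimator on the span of an orthonormal system `b`. -/
def projectionEstimator {ι : Type*} [Fintype ι] (b : ι → C(unitInterval, ℝ)) (m : ℕ)
    (y : unitInterval → ℝ) (x : unitInterval) : ℝ :=
  ∑ a, riemannSum m (b a) y * b a x

lemma isEstimator_projectionEstimator {ι : Type*} [Fintype ι] (b : ι → C(unitInterval, ℝ))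
    (m : ℕ) : IsEstimator (projectionEstimator b m) := fun _ ↦
  Finset.measurable_sum _ fun a _ ↦ (measurable_riemannSum m (b a)).mul_const _

/-- The risk of the projection estimator, for a grid fine enough. -/
theorem lintegral_supDist_projectionEstimator_le [IsProbabilityMeasure P] {ι : Type*} [Fintype ι]
    (hB : IsPreBrownianReal B P) (n : ℕ) (b : ι → C(unitInterval, ℝ)) {m : ℕ} (hm : m ≠ 0)
    {τ : ℝ} (hτ0 : 0 ≤ τ) (hτ : τ ≤ 1)
    (hb : ∀ a i, ∀ x ∈ Set.Ioc (gridPoint m i) (gridPoint m (i + 1)),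
      |b a x - b a (gridPoint m i)| ≤ τ) (hb1 : ∀ a, ∫ x, b a x ^ 2 = 1)
    {G : ℝ} (hG : ∀ x, ∑ a, |b a x| ≤ G) {f : C(unitInterval, ℝ)} {D : ℝ} (hf : ∀ x, |f x| ≤ D)
    {e : ℝ}
    (he : ∀ x : unitInterval, |f x - ∑ a, (∫ u, f u * b a u) * b a x| ≤ e) {t A : ℝ} (ht : 0 < t)
    (hA : 1 ≤ A) :
    ∫⁻ ω, supDist (projectionEstimator b m (whiteNoise B n f ω)) f ∂P ≤
      ENNReal.ofReal (e + G * (τ * D + (Real.log A +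
        2 * Fintype.card ι * Real.exp (2 * t ^ 2 / n) / A) / t)) := by
  have hA0 : 0 < A := by linarith
  have hG0 : 0 ≤ G := (Finset.sum_nonneg fun a _ ↦ abs_nonneg _).trans (hG 0)
  have he0 : 0 ≤ e := (abs_nonneg _).trans (he 0)
  have hD0 : 0 ≤ D := (abs_nonneg _).trans (hf 0)
  let Z : ι → Ω → ℝ := fun a ω ↦ riemannSum m (b a) (whiteNoise B n 0 ω)
  -- An integrable majorant of all `|Z a|`: use `y + 1 ≤ e^y` at `y = t |Z a| - log A`, then bound
  -- one exponential by the sum of all.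
  let V : Ω → ℝ := fun ω ↦ (Real.log A +
    (∑ a, (Real.exp (t * Z a ω) + Real.exp (-t * Z a ω))) / A) / t
  have hZV : ∀ a ω, |Z a ω| ≤ V ω := fun a ω ↦ by
    rw [le_div_iff₀ ht]
    have h1 := Real.add_one_le_exp (|t * Z a ω| - Real.log A)
    rw [Real.exp_sub, Real.exp_log hA0] at h1
    have h2 : Real.exp |t * Z a ω| / A ≤
        (∑ a, (Real.exp (t * Z a ω) + Real.exp (-t * Z a ω))) / A := by
      gcongr
      calc Real.exp |t * Z a ω| ≤ Real.exp (t * Z a ω) + Real.exp (-t * Z a ω) := by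
            rw [neg_mul]; exact Real.exp_abs_le _
        _ ≤ _ := Finset.single_le_sum
            (f := fun a ↦ Real.exp (t * Z a ω) + Real.exp (-t * Z a ω))
            (fun _ _ ↦ by positivity) (Finset.mem_univ a)
    rw [abs_mul, abs_of_pos ht] at h1
    rw [abs_mul, abs_of_pos ht] at h2
    linarith
  have hV0 : ∀ ω, 0 ≤ V ω := fun ω ↦ by
    have := Real.log_nonneg hA
    positivity
  have hsum_i : Integrable (fun ω ↦ ∑ a, (Real.exp (t * Z a ω) + Real.exp (-t * Z a ω))) P :=
    integrable_finsetSum _ fun a _ ↦ (integrable_exp_riemannSum hB n m _ t).add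
      (integrable_exp_riemannSum hB n m _ (-t))
  have hVi : Integrable V P := ((integrable_const _).add (hsum_i.div_const A)).div_const t
  have hVint : ∫ ω, V ω ∂P ≤ (Real.log A +
      2 * Fintype.card ι * Real.exp (2 * t ^ 2 / n) / A) / t := by
    have h1 : ∫ ω, ∑ a, (Real.exp (t * Z a ω) + Real.exp (-t * Z a ω)) ∂P ≤
        2 * Fintype.card ι * Real.exp (2 * t ^ 2 / n) := by
      have h0 : ∀ a ∈ Finset.univ, Integrable
          (fun ω ↦ Real.exp (t * Z a ω) + Real.exp (-t * Z a ω)) P := fun a _ ↦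
        (integrable_exp_riemannSum hB n m _ t).add (integrable_exp_riemannSum hB n m _ (-t))
      rw [integral_finsetSum _ h0]
      calc _ ≤ ∑ _a : ι, 2 * Real.exp (2 * t ^ 2 / n) := by
            refine Finset.sum_le_sum fun a _ ↦ ?_
            rw [integral_add (integrable_exp_riemannSum hB n m _ t)
              (integrable_exp_riemannSum hB n m _ (-t))]
            have h2 := mgf_riemannSum_le hB n hm hτ (hb a) (hb1 a) t
            have h3 := mgf_riemannSum_le hB n hm hτ (hb a) (hb1 a) (-t)
            rw [neg_sq] at h3
            rw [mgf] at h2 h3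
            linarith
        _ = _ := by rw [Finset.sum_const, Finset.card_univ, nsmul_eq_mul]; ring
    simp only [V]
    rw [integral_div, integral_add (integrable_const _) (hsum_i.div_const A), integral_div]
    simp only [integral_const, probReal_univ, one_smul]
    gcongr
  have hpt : ∀ ω, supDist (projectionEstimator b m (whiteNoise B n f ω)) f ≤
      ENNReal.ofReal (e + G * (τ * D + V ω)) := fun ω ↦ by
    refine iSup_le fun x ↦ ENNReal.ofReal_le_ofReal ?_
    have h1 : projectionEstimator b m (whiteNoise B n f ω) x - f x =
        ∑ a, (riemannSum m (b a) (whiteNoise B n f ω) - ∫ u, f u * b a u) * b a x -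
          (f x - ∑ a, (∫ u, f u * b a u) * b a x) := by
      simp only [projectionEstimator, sub_mul, Finset.sum_sub_distrib]; ring
    have h2 : ∀ a, |riemannSum m (b a) (whiteNoise B n f ω) - ∫ u, f u * b a u| ≤
        τ * D + V ω := fun a ↦ by
      rw [riemannSum_whiteNoise, add_sub_right_comm]
      exact (abs_add_le _ _).trans (add_le_add
        (abs_sum_mul_setIntegral_sub_le hm (b a) f hτ0 (hb a) hf) (hZV a ω))
    have h3 := IntervalWavelets.IsWaveletBasis.abs_sum_mul_le
      (add_nonneg (mul_nonneg hτ0 hD0) (hV0 ω)) h2 (hG x)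
    rw [h1]
    refine (abs_sub _ _).trans ?_
    linarith [he x]
  have hint : Integrable (fun ω ↦ e + G * (τ * D + V ω)) P :=
    (integrable_const _).add (((integrable_const _).add hVi).const_mul G)
  calc _ ≤ ∫⁻ ω, ENNReal.ofReal (e + G * (τ * D + V ω)) ∂P := lintegral_mono hpt
    _ = ENNReal.ofReal (∫ ω, (e + G * (τ * D + V ω)) ∂P) := by
        rw [ofReal_integral_eq_lintegral_ofReal hint (ae_of_all _ fun ω ↦ by
          have := hV0 ω
          positivity)]
    _ ≤ _ := by
        refine ENNReal.ofReal_le_ofReal ?_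
        have hVi' : Integrable (fun ω ↦ τ * D + V ω) P := (integrable_const _).add hVi
        rw [integral_add (integrable_const _) (hVi'.const_mul G), integral_const_mul,
          integral_add (integrable_const _) hVi]
        simp only [integral_const, probReal_univ, one_smul]
        gcongr

end WhiteNoise

/-! ### Upper bound over the Hölder class -/

namespace IntervalWavelets.IsWaveletBasis

variable {W : IntervalWavelets}

/-- The elements of the wavelet basis at resolution levels up to `J`. -/
def basisUpTo (hW : W.IsWaveletBasis) (J : ℕ) :
    Fin (2 ^ W.j₀) ⊕ (Σ j : Finset.Icc W.j₀ J, Fin (2 ^ (j : ℕ))) → C(unitInterval, ℝ) :=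
  Sum.elim hW.scalingMap fun p ↦ hW.waveletMap p.1 p.2

lemma integral_sq_basisUpTo (hW : W.IsWaveletBasis) (J : ℕ)
    (a : Fin (2 ^ W.j₀) ⊕ (Σ j : Finset.Icc W.j₀ J, Fin (2 ^ (j : ℕ)))) :
    ∫ x, hW.basisUpTo J a x ^ 2 = 1 := by
  rcases a with k | ⟨j, k⟩
  · have h := hW.alpha_scalingMap k k
    rw [if_pos rfl] at h
    simp only [sq]
    exact h
  · exact hW.integral_sq_waveletMap (Finset.mem_Icc.1 j.2).1 k

lemma sum_basisUpTo (hW : W.IsWaveletBasis) (J : ℕ) (f : C(unitInterval, ℝ))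
    (x : unitInterval) :
    ∑ a, (∫ u, f u * hW.basisUpTo J a u) * hW.basisUpTo J a x =
      hW.scalingLevelMap (fun k ↦ W.alpha f k) x +
        ∑ j ∈ Finset.Icc W.j₀ J, hW.levelMap j (fun k ↦ W.beta f j k) x := by
  rw [Fintype.sum_sum_type, Fintype.sum_sigma, scalingLevelMap_apply,
    ← Finset.sum_coe_sort (Finset.Icc W.j₀ J)]
  simp only [levelMap_apply]
  rfl

lemma card_basisUpTo_le {J : ℕ} (hJ : W.j₀ ≤ J) :
    Fintype.card (Fin (2 ^ W.j₀) ⊕ (Σ j : Finset.Icc W.j₀ J, Fin (2 ^ (j : ℕ)))) ≤ 3 * 2 ^ J := by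
  rw [Fintype.card_sum, Fintype.card_sigma, Fintype.card_fin]
  simp only [Fintype.card_fin]
  rw [Finset.sum_coe_sort (Finset.Icc W.j₀ J) (fun j ↦ 2 ^ j)]
  have h1 : ∑ j ∈ Finset.Icc W.j₀ J, 2 ^ j ≤ ∑ j ∈ Finset.range (J + 1), 2 ^ j :=
    Finset.sum_le_sum_of_subset fun j hj ↦ by
      have := Finset.mem_Icc.1 hj
      rw [Finset.mem_range]; omega
  have h2 : ∑ j ∈ Finset.range (J + 1), 2 ^ j < 2 ^ (J + 1) := Nat.geomSum_lt le_rfl (by simp)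
  have h3 : 2 ^ W.j₀ ≤ 2 ^ J := Nat.pow_le_pow_right (by norm_num) hJ
  rw [pow_succ] at h2
  omega

lemma exists_sum_abs_basisUpTo_le (hW : W.IsWaveletBasis) :
    ∃ C > 0, ∀ J, W.j₀ ≤ J → ∀ x, ∑ a, |hW.basisUpTo J a x| ≤ C * (2 : ℝ) ^ ((J : ℝ) / 2) := by
  obtain ⟨C₁, h1, hs1⟩ := hW.exists_sum_abs_scalingFn_le
  obtain ⟨C₂, h2, hs2⟩ := hW.exists_sum_abs_waveletFn_le
  -- The levels grow geometrically with ratio `√2`, so the last one dominates the sum.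
  set q : ℝ := √2 with hq
  have hq1 : 1 < q := by rw [hq, Real.lt_sqrt (by norm_num)]; norm_num
  have hqpow : ∀ j : ℕ, q ^ j = (2 : ℝ) ^ ((j : ℝ) / 2) := fun j ↦ by
    rw [hq, Real.sqrt_eq_rpow, ← Real.rpow_natCast, ← Real.rpow_mul (by norm_num)]
    congr 1; ring
  have hq0 : 0 < q - 1 := by linarith
  refine ⟨C₁ + C₂ * (q / (q - 1)), by positivity, fun J hJ x ↦ ?_⟩
  rw [Fintype.sum_sum_type, Fintype.sum_sigma]
  have e1 : ∑ k, |hW.basisUpTo J (.inl k) x| ≤ C₁ * q ^ J :=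
    (hs1 x).trans (by rw [← hqpow]; gcongr; exact hq1.le)
  have e2 : ∑ j : Finset.Icc W.j₀ J, ∑ k : Fin (2 ^ (j : ℕ)),
      |hW.basisUpTo J (.inr ⟨j, k⟩) x| ≤ C₂ * (q / (q - 1)) * q ^ J := by
    calc _ ≤ ∑ j : Finset.Icc W.j₀ J, C₂ * q ^ (j : ℕ) :=
          Finset.sum_le_sum fun j _ ↦ (hs2 j x).trans (by rw [hqpow])
      _ = ∑ j ∈ Finset.Icc W.j₀ J, C₂ * q ^ j :=
          Finset.sum_coe_sort (Finset.Icc W.j₀ J) (fun j ↦ C₂ * q ^ j)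
      _ ≤ ∑ j ∈ Finset.range (J + 1), C₂ * q ^ j :=
          Finset.sum_le_sum_of_subset_of_nonneg (fun j hj ↦ by
            have := Finset.mem_Icc.1 hj
            rw [Finset.mem_range]; omega) fun _ _ _ ↦ by positivity
      _ = C₂ * ((q ^ (J + 1) - 1) / (q - 1)) := by
          rw [← Finset.mul_sum, geom_sum_eq hq1.ne']
      _ ≤ C₂ * (q ^ (J + 1) / (q - 1)) := by gcongr; linarith
      _ = C₂ * (q / (q - 1)) * q ^ J := by rw [pow_succ]; ring
  rw [← hqpow, add_mul]
  exact add_le_add e1 e2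

/-- Upper bound for the minimax risk over `C^s(M)`, by a projection estimator. -/
theorem exists_minimaxRisk_le (hW : W.IsWaveletBasis) {Ω : Type*} [MeasurableSpace Ω]
    {P : Measure Ω} {B : ℝ≥0 → Ω → ℝ} [IsProbabilityMeasure P] (hB : IsPreBrownianReal B P)
    {s M : ℝ} (hs : 0 < s) (hM : 0 < M) :
    ∃ C > 0, ∀ᶠ n : ℕ in atTop, minimaxRisk P B (W.holderClass s M) n ≤
      ENNReal.ofReal (C * optimalRate s n) := by
  obtain ⟨C₁, hC₁, happrox⟩ := hW.exists_approx hs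
  obtain ⟨D, hD, hbound⟩ := hW.exists_abs_le hs hM.le
  obtain ⟨C₂, hC₂, hbasis⟩ := hW.exists_sum_abs_basisUpTo_le
  set β : ℝ := 1 / (2 * s + 1) with hβ
  have hβ0 : 0 < β := by positivity
  have hβ1 : β ≤ 1 := by rw [hβ, div_le_one (by positivity)]; linarith
  refine ⟨M * C₁ * 2 ^ s + C₂ * (D + 9), by positivity, ?_⟩
  filter_upwards [eventually_ge_atTop 3,
    (tendsto_div_log_rpow hβ0).eventually_ge_atTop (2 ^ (W.j₀ + 1)),
    (Real.tendsto_log_atTop.comp tendsto_natCast_atTop_atTop).eventually_ge_atTop 1]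
    with n hn3 hnj hlog
  have hn0 : (0 : ℝ) < n := by positivity
  have hn1 : (1 : ℝ) ≤ n := by exact_mod_cast (by omega : 1 ≤ n)
  replace hlog : 1 ≤ Real.log n := hlog
  have hl : 0 < Real.log n := by linarith
  set Q : ℝ := (n : ℝ) / Real.log n with hQ
  have hQ0 : 0 < Q := by positivity
  set R : ℝ := Q ^ β with hR
  have hR0 : 0 < R := by positivity
  have hR1 : 1 ≤ R := (one_le_pow₀ (by norm_num)).trans hnj
  have hQ1 : 1 ≤ Q := by
    by_contra! h
    exact absurd (Real.rpow_lt_one hQ0.le h hβ0) (not_lt.2 hR1)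
  have hQn : Q ≤ n := div_le_self hn0.le hlog
  have hRn : R ≤ n := (Real.rpow_le_self_of_one_le hQ1 hβ1).trans hQn
  obtain ⟨J, hJ1, hJ2⟩ := exists_nat_pow_near hR1 (one_lt_two (α := ℝ))
  have hJ : W.j₀ ≤ J := by
    have := (pow_lt_pow_iff_right₀ (one_lt_two (α := ℝ))).1 (hnj.trans_lt hJ2)
    omega
  have hpJ : (2 : ℝ) ^ (J : ℝ) = 2 ^ J := Real.rpow_natCast _ _
  set p : ℝ := Q ^ (-(1 / 2) : ℝ) with hp
  have hp0 : 0 < p := by positivity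
  have hp1 : p ≤ 1 := Real.rpow_le_one_of_one_le_of_nonpos hQ1 (by norm_num)
  have hpp : n * (p * p) = Real.log n := by
    rw [hp, ← Real.rpow_add hQ0]
    norm_num
    rw [Real.rpow_neg_one, hQ]
    field_simp
  obtain ⟨m, hm, hgrid⟩ := exists_grid (hW.basisUpTo J) hp0
  refine (iInf₂_le _ (isEstimator_projectionEstimator (hW.basisUpTo J) m)).trans
    (iSup₂_le fun f hf ↦ ?_)
  -- `t = n p` makes `log n / t = p` and the moment bound `e^{2t²/n} = n²`. With at most `3n` basis
  -- functions, `A = n³` keeps the exponential term bounded. The grid error `p D` is of the order of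
  -- the noise.
  have hmain := lintegral_supDist_projectionEstimator_le hB n (hW.basisUpTo J) hm hp0.le hp1
    hgrid (hW.integral_sq_basisUpTo J) (hbasis J hJ) (hbound f hf)
    (e := M * C₁ * (2 : ℝ) ^ (-(J : ℝ) * s))
    (fun x ↦ by rw [sum_basisUpTo]; exact happrox M f hM.le hf J x)
    (t := n * p) (A := (n : ℝ) ^ 3) (by positivity) (one_le_pow₀ hn1)
  refine hmain.trans (ENNReal.ofReal_le_ofReal ?_)
  have hrate1 : (2 : ℝ) ^ (-(J : ℝ) * s) ≤ 2 ^ s * optimalRate s n := by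
    have h1 : (R / 2) ^ s ≤ ((2 : ℝ) ^ J) ^ s := by
      rw [pow_succ] at hJ2
      gcongr
      linarith
    have h2 : optimalRate s n = (R ^ s)⁻¹ := by
      rw [hR, ← Real.rpow_mul hQ0.le, ← Real.rpow_neg hQ0.le, optimalRate]
      congr 1
      rw [hβ]; field_simp
    rw [h2, neg_mul, Real.rpow_neg (by norm_num), Real.rpow_mul (by norm_num), hpJ]
    calc (((2 : ℝ) ^ J) ^ s)⁻¹ ≤ ((R / 2) ^ s)⁻¹ := by gcongr
      _ = _ := by rw [Real.div_rpow hR0.le (by norm_num), inv_div]; rfl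
  have hrate2 : (2 : ℝ) ^ ((J : ℝ) / 2) * p ≤ optimalRate s n := by
    have h2 : optimalRate s n = R ^ (1 / 2 : ℝ) * p := by
      rw [hR, hp, ← Real.rpow_mul hQ0.le, ← Real.rpow_add hQ0, optimalRate]
      congr 1
      rw [hβ]; field_simp; ring
    rw [h2]
    gcongr
    calc (2 : ℝ) ^ ((J : ℝ) / 2) = ((2 : ℝ) ^ J) ^ (1 / 2 : ℝ) := by
          rw [← hpJ, ← Real.rpow_mul (by norm_num)]; congr 1; ring
      _ ≤ R ^ (1 / 2 : ℝ) := by gcongr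
  have hexp : Real.exp (2 * (n * p) ^ 2 / n) = (n : ℝ) ^ 2 := by
    have : 2 * (n * p) ^ 2 / n = Real.log n * 2 := by rw [← hpp]; field_simp
    rw [this, ← Real.rpow_def_of_pos hn0]
    norm_num
  have hcard : (Fintype.card (Fin (2 ^ W.j₀) ⊕ (Σ j : Finset.Icc W.j₀ J, Fin (2 ^ (j : ℕ)))) : ℝ)
      ≤ 3 * n := by
    have h1 : (Fintype.card (Fin (2 ^ W.j₀) ⊕ (Σ j : Finset.Icc W.j₀ J, Fin (2 ^ (j : ℕ)))) : ℝ)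
        ≤ 3 * 2 ^ J := by exact_mod_cast card_basisUpTo_le hJ
    linarith
  -- Here `9 = 3 + 6`: `log A = 3 log n`, and the exponential term is at most `6 ≤ 6 log n`.
  have hnoise : (Real.log ((n : ℝ) ^ 3) + 2 *
      (Fintype.card (Fin (2 ^ W.j₀) ⊕ (Σ j : Finset.Icc W.j₀ J, Fin (2 ^ (j : ℕ)))) : ℝ) *
      Real.exp (2 * (n * p) ^ 2 / n) / (n : ℝ) ^ 3) / (n * p) ≤ 9 * p := by
    rw [hexp, div_le_iff₀ (by positivity), Real.log_pow]
    have h1 : 2 * (Fintype.card (Fin (2 ^ W.j₀) ⊕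
        (Σ j : Finset.Icc W.j₀ J, Fin (2 ^ (j : ℕ)))) : ℝ) * (n : ℝ) ^ 2 / (n : ℝ) ^ 3 ≤ 6 := by
      rw [div_le_iff₀ (by positivity)]
      calc _ ≤ 2 * (3 * (n : ℝ)) * (n : ℝ) ^ 2 := by gcongr
        _ = 6 * (n : ℝ) ^ 3 := by ring
    have h2 : 9 * p * (n * p) = 9 * Real.log n := by rw [← hpp]; ring
    rw [h2]
    push_cast
    linarith
  calc _ ≤ M * C₁ * (2 ^ s * optimalRate s n) +
        C₂ * (2 : ℝ) ^ ((J : ℝ) / 2) * (p * D + 9 * p) := by gcongr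
    _ = M * C₁ * 2 ^ s * optimalRate s n +
        C₂ * (D + 9) * ((2 : ℝ) ^ ((J : ℝ) / 2) * p) := by ring
    _ ≤ M * C₁ * 2 ^ s * optimalRate s n + C₂ * (D + 9) * optimalRate s n := by gcongr
    _ = _ := by ring

end IntervalWavelets.IsWaveletBasis

end

theorem mainTheorem4 {Ω : Type*} [MeasurableSpace Ω] (P : Measure Ω) [IsProbabilityMeasure P]
    (B : ℝ≥0 → Ω → ℝ) (hB : IsBrownianReal B P)
    (W : IntervalWavelets) (hW : W.IsWaveletBasis)
    (smax ε : ℝ) (ρ : ℕ) (hsmax : smax < W.N) (hε : 0 < ε) (hε1 : ε < 1) (hρ : 1 ≤ ρ)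
    (γ s M : ℝ) (hγ : 0 < γ) (hγ1 : γ < 1 / 2) (hs : 0 < s) (hs1 : s ≤ smax) (hM : 0 < M) :
    (∀ T : ℕ → (unitInterval → ℝ) → unitInterval → ℝ, (∀ n, IsEstimator (T n)) →
      ∀ r : ℕ → ℝ, r =o[atTop] optimalRate s →
        ¬ (limsup (fun n : ℕ ↦ ⨆ f ∈ W.selfSimilarClass smax ε ρ s M,
            P {ω | ENNReal.ofReal (r n) ≤ supDist (T n (whiteNoise B n f ω)) f}) atTop
          ≤ ENNReal.ofReal γ)) ∧
    IsMinimaxRate P B (W.selfSimilarClass smax ε ρ s M) (optimalRate s) ∧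
    IsMinimaxRate P B (W.holderClass s M) (optimalRate s) := by
  have hB' := hB.toIsPreBrownianReal
  obtain ⟨c, hc, hlower⟩ := hW.exists_le_minimaxRisk hB' (smax := smax) hε1 hρ hs hM
  obtain ⟨C, hC, hupper⟩ := hW.exists_minimaxRisk_le hB' hs hM
  -- The risk is monotone in the class, so each bound serves both classes.
  have hsub : W.selfSimilarClass smax ε ρ s M ⊆ W.holderClass s M := fun f hf ↦ hf.1
  refine ⟨fun T hT r hr ↦ hW.not_limsup_le hB' hε1 hρ hs hM hγ hγ1 hT hr,
    ⟨c, hc, C, hC, ?_⟩, ⟨c, hc, C, hC, ?_⟩⟩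
  · filter_upwards [hlower, hupper] with n h1 h2
    exact ⟨h1, (minimaxRisk_mono hsub n).trans h2⟩
  · filter_upwards [hlower, hupper] with n h1 h2
    exact ⟨h1.trans (minimaxRisk_mono hsub n), h2⟩
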